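/- A workflow $W=(S,U,\leqslant,A,C)$ consists of a finite poset $(S,\leqslant)$ of $k$ steps, a finite set $U$ of $n$ users, an authorization relation $A\subseteq S\times U$ such that every step $s$ has some user $u$ with $(s,u)\in A$, and a family $C$ of $c$ constraints; each constraint $\gamma$ is given by a finite code and stands for a set of plans $\pi:S\to U$, those that satisfy $\gamma$. A plan is valid if $(s,\pi(s))\in A$ for all $s\in S$ and it satisfies every $\gamma\in C$. For a plan $\pi$ let $[s]_\pi=\{s'\in S:\pi(s')=\pi(s)\}$ and $S/\pi=\{[s]_\pi : s\in S\}$. A set $F\subseteq S$ is $\gamma$-ineligible if every plan $\pi$ with $F\in S/\pi$ violates $\gamma$, and $\gamma$-eligible otherwise. The constraint $\gamma$ is regular if every plan $\pi$ for which all classes $[s]_\pi$, $s\in S$, are $\gamma$-eligible satisfies $\gamma$. Running times are measured on a random access machine with logarithmic cost that has random access to the input. Let $\mathcal W$ be a class of workflows such that (i) every constraint of every $W\in\mathcal W$ is regular, and (ii) there is an algorithm that, given $W\in\mathcal W$, a constraint $\gamma$ of $W$ and a set $F\subseteq S$, determines whether $F$ is $\gamma$-eligible in time polynomial in $k$ (it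 suffices: polynomial in $k$, $\log n$ and $\log c$). Then the workflow satisfiability problem for $\mathcal W$ can be solved in time $\widetilde O(2^k(c+n^2))$: there are an algorithm and constants $K,d$ such that for every $W\in\mathcal W$ the algorithm outputs a valid plan, or correctly reports that there is none, in time at most $K\,(T\log^d T+1)$, where $T=2^k(c+n^2)$ and $\log$ is the binary logarithm (rounded down, and taken to be $0$ for $T=0$). -/

import Mathlib

/-! ## Random access machine with logarithmic cost

Structured programs over a random access memory.  There are registers, named in the program text,
a read-only input and a work memory, the latter two addressed indirectly: cell `i` of array `a`.
Registers and cells hold natural numbers of any size; every operation is charged one unit plus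
the bit lengths of all the numbers (addresses included) that it handles. -/

namespace RAM

/-- Arithmetic operations: addition, truncated subtraction, multiplication, floor division. -/
inductive Op where
  | add
  | sub
  | mul
  | div

def Op.eval : Op → ℕ → ℕ → ℕ
  | .add, a, b => a + b
  | .sub, a, b => a - b
  | .mul, a, b => a * b
  | .div, a, b => a / b

/-- Programs.  All arguments of type `ℕ` are names of registers, except the value `v`. -/
inductive Prog where
  | skip : Prog
  /-- `x := v` -/
  | const (x v : ℕ) : Prog
  /-- `x := y o z` -/
  | op (o : Op) (x y z : ℕ) : Prog
  /-- `x := input[y][z]` -/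
  | input (x y z : ℕ) : Prog
  /-- `x := memory[y][z]` -/
  | load (x y z : ℕ) : Prog
  /-- `memory[y][z] := x` -/
  | store (y z x : ℕ) : Prog
  | seq (p q : Prog) : Prog
  /-- if `x ≠ 0` then `p` else `q` -/
  | ite (x : ℕ) (p q : Prog) : Prog
  /-- while `x ≠ 0` do `p` -/
  | loop (x : ℕ) (p : Prog) : Prog

structure State where
  reg : ℕ → ℕ
  mem : ℕ → ℕ → ℕ

def State.setReg (σ : State) (x v : ℕ) : State :=
  { σ with reg := Function.update σ.reg x v }

def State.setMem (σ : State) (a i v : ℕ) : State :=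
  { σ with mem := Function.update σ.mem a (Function.update (σ.mem a) i v) }

/-- The state in which a program starts: the arguments in the first registers, zero elsewhere. -/
def start (args : List ℕ) : State where
  reg i := args.getD i 0
  mem _ _ := 0

/-- `Runs inp p σ t σ'`: on the input `inp`, the program `p` started in the state `σ` halts in the
state `σ'`, at the total cost `t`. -/
inductive Runs (inp : ℕ → ℕ → ℕ) : Prog → State → ℕ → State → Prop where
  | skip (σ : State) : Runs inp .skip σ 1 σ
  | const (σ : State) (x v : ℕ) : Runs inp (.const x v) σ (1 + v.size) (σ.setReg x v)
  | op (σ : State) (o : Op) (x y z : ℕ) :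
      Runs inp (.op o x y z) σ
        (1 + (σ.reg y).size + (σ.reg z).size + (o.eval (σ.reg y) (σ.reg z)).size)
        (σ.setReg x (o.eval (σ.reg y) (σ.reg z)))
  | input (σ : State) (x y z : ℕ) :
      Runs inp (.input x y z) σ
        (1 + (σ.reg y).size + (σ.reg z).size + (inp (σ.reg y) (σ.reg z)).size)
        (σ.setReg x (inp (σ.reg y) (σ.reg z)))
  | load (σ : State) (x y z : ℕ) :
      Runs inp (.load x y z) σ
        (1 + (σ.reg y).size + (σ.reg z).size + (σ.mem (σ.reg y) (σ.reg z)).size)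
        (σ.setReg x (σ.mem (σ.reg y) (σ.reg z)))
  | store (σ : State) (y z x : ℕ) :
      Runs inp (.store y z x) σ
        (1 + (σ.reg y).size + (σ.reg z).size + (σ.reg x).size)
        (σ.setMem (σ.reg y) (σ.reg z) (σ.reg x))
  | seq {p q : Prog} {σ σ' σ'' : State} {t t' : ℕ} :
      Runs inp p σ t σ' → Runs inp q σ' t' σ'' → Runs inp (.seq p q) σ (t + t') σ''
  | ite_true {x : ℕ} {p q : Prog} {σ σ' : State} {t : ℕ} :
      σ.reg x ≠ 0 → Runs inp p σ t σ' →
        Runs inp (.ite x p q) σ (1 + (σ.reg x).size + t) σ'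
  | ite_false {x : ℕ} {p q : Prog} {σ σ' : State} {t : ℕ} :
      σ.reg x = 0 → Runs inp q σ t σ' → Runs inp (.ite x p q) σ (1 + t) σ'
  | loop_true {x : ℕ} {p : Prog} {σ σ' σ'' : State} {t t' : ℕ} :
      σ.reg x ≠ 0 → Runs inp p σ t σ' → Runs inp (.loop x p) σ' t' σ'' →
        Runs inp (.loop x p) σ (1 + (σ.reg x).size + t + t') σ''
  | loop_false {x : ℕ} {p : Prog} {σ : State} :
      σ.reg x = 0 → Runs inp (.loop x p) σ 1 σ

end RAM

/-! ## Workflows -/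

namespace WSP

/-- A plan assigns a user to every step; there are `k` steps and `n` users. -/
abbrev Plan (k n : ℕ) := Fin k → Fin n

/-- The equivalence class of the step `s` under the plan `π`: the steps that the user of `s`
performs. -/
def Plan.block {k n : ℕ} (π : Plan k n) (s : Fin k) : Finset (Fin k) :=
  Finset.univ.filter fun s' => π s' = π s

/-- A constraint: its syntax, which is what an algorithm gets to see (a finite sequence of
numbers in any encoding), and its meaning, the plans that satisfy it. -/
structure Constraint (k n : ℕ) where
  code : List ℕ
  sat : Plan k n → Prop

namespace Constraint

variable {k n : ℕ}

/-- `F` is ineligible if every plan that has `F` as one of its equivalence classes violates the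
constraint. -/
def Ineligible (γ : Constraint k n) (F : Finset (Fin k)) : Prop :=
  ∀ π : Plan k n, (∃ s, F = π.block s) → ¬ γ.sat π

def Eligible (γ : Constraint k n) (F : Finset (Fin k)) : Prop :=
  ¬ γ.Ineligible F

/-- Every plan all of whose equivalence classes are eligible satisfies the constraint. -/
def Regular (γ : Constraint k n) : Prop :=
  ∀ π : Plan k n, (∀ s, γ.Eligible (π.block s)) → γ.sat π

end Constraint

/-- A constrained workflow authorization schema with `k` steps, `n` users and `c` constraints;
for every step there is an authorized user. -/
structure Workflow where
  k : ℕ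
  n : ℕ
  c : ℕ
  order : PartialOrder (Fin k)
  auth : Fin k → Fin n → Prop
  exists_auth : ∀ s, ∃ u, auth s u
  con : Fin c → Constraint k n

namespace Workflow

/-- A plan is valid if it is authorized and satisfies all constraints. -/
def Valid (W : Workflow) (π : Plan W.k W.n) : Prop :=
  (∀ s, W.auth s (π s)) ∧ ∀ j, (W.con j).sat π

open Classical in
/-- The workflow as the input of a program.  Array 0 holds `k`, `n`, `c`; arrays 1 and 2 hold
the 0/1 matrices of the order and of the authorization relation, row by row; array `j + 3` holds
the code of the `j`-th constraint, preceded by its length. -/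
noncomputable def input (W : Workflow) : ℕ → ℕ → ℕ
  | 0, i => [W.k, W.n, W.c].getD i 0
  | 1, i => if ∃ s s' : Fin W.k, i = s * W.k + s' ∧ W.order.le s s' then 1 else 0
  | 2, i => if ∃ (s : Fin W.k) (u : Fin W.n), i = s * W.n + u ∧ W.auth s u then 1 else 0
  | j + 3, i =>
      if h : j < W.c then ((W.con ⟨j, h⟩).code.length :: (W.con ⟨j, h⟩).code).getD i 0 else 0

/-- The quantity `2 ^ k * (c + n ^ 2)`. -/
def bound (W : Workflow) : ℕ := 2 ^ W.k * (W.c + W.n ^ 2)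

end Workflow

/-- A set of steps as a number: bit `s` is set if and only if `s ∈ F`. -/
def mask {k : ℕ} (F : Finset (Fin k)) : ℕ := ∑ s ∈ F, 2 ^ (s : ℕ)

open Classical in
/-- On the input `W` and the arguments `j` (index of a constraint) and `F` (a set of steps), the
program `E` decides, at cost at most `B`, whether `F` is eligible for the `j`-th constraint. -/
def DecidesEligibility (E : RAM.Prog) (W : Workflow) (B : ℕ) : Prop :=
  ∀ (j : Fin W.c) (F : Finset (Fin W.k)), ∃ (t : ℕ) (σ : RAM.State),
    RAM.Runs W.input E (RAM.start [(j : ℕ), mask F]) t σ ∧ t ≤ B ∧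
      σ.reg 0 = if (W.con j).Eligible F then 1 else 0

/-- On the input `W`, the program `P` solves the workflow satisfiability problem at cost at most
`B`: it answers 1 and leaves a valid plan in array 0 of the memory, or it answers 0 and there is
no valid plan. -/
def Solves (P : RAM.Prog) (W : Workflow) (B : ℕ) : Prop :=
  ∃ (t : ℕ) (σ : RAM.State),
    RAM.Runs W.input P (RAM.start []) t σ ∧ t ≤ B ∧
      ((σ.reg 0 = 1 ∧ ∃ π, W.Valid π ∧ ∀ s : Fin W.k, σ.mem 0 s = (π s : ℕ)) ∨
        (σ.reg 0 = 0 ∧ ¬ ∃ π, W.Valid π))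

end WSP

/-!
By regularity, a plan is valid if and only if every user is given a set of steps that fits: it is
empty or eligible for all constraints, and the user is authorized for its steps. Let `Coverable u F`
mean that `F` is a disjoint union of sets that fit the first `u` users. If the indicator functions
of `Coverable u` and of the sets that fit the user `u` are weighted by `b ^ |F|`, the sum of the
products over all pairs `X`, `Y` with `X ∪ Y = F` has terms `b ^ (|X| + |Y|)`: those with
disjoint `X` and `Y` are `b ^ |F|`, the others are multiples of `b ^ (|F| + 1)`, and there are fewer
than `b = 2 ^ (k + 1)` of the former, so that they can be detected modulo `b ^ (|F| + 1)`. The fast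
zeta and Möbius transforms yield these sums for all `F` with `O(2 ^ k * k)` operations per user.
If all steps can be covered, going back from the last user to the first one finds a plan, by a
search through all sets per user.

The eligibility test starts in an empty memory. Each of its `2 ^ k * c` runs therefore has arrays of
its own: their numbers form a residue class modulo a number larger than that of all runs.
-/

namespace RAM

/-! ## Running a program within a budget -/

infixr:60 " ;; " => Prog.seq

@[simp] theorem State.reg_setReg (σ : State) (x v r : ℕ) :
    (σ.setReg x v).reg r = if r = x then v else σ.reg r := by
  simp [State.setReg, Function.update_apply]

@[simp] theorem State.mem_setReg (σ : State) (x v : ℕ) : (σ.setReg x v).mem = σ.mem := rfl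

/-- The contents of the work memory: the value of cell `i` of array `a`. -/
abbrev Mem := ℕ → ℕ → ℕ

/-- The memory after the assignment `memory[a][i] := v`. -/
def Mem.set (μ : Mem) (a i v : ℕ) : Mem := Function.update μ a (Function.update (μ a) i v)

@[simp] theorem State.mem_setMem (σ : State) (a i v : ℕ) :
    (σ.setMem a i v).mem = Mem.set σ.mem a i v := rfl

theorem Mem.set_apply (μ : Mem) (a i v b j : ℕ) :
    μ.set a i v b j = if b = a ∧ j = i then v else μ b j := by
  by_cases h : b = a
  · subst h; simp [Mem.set, Function.update_apply]
  · simp [Mem.set, h]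

@[simp] theorem Mem.set_self (μ : Mem) (a i v : ℕ) : μ.set a i v a i = v := by
  simp [Mem.set_apply]

theorem Mem.set_of_ne (μ : Mem) {a b : ℕ} (h : b ≠ a) (i v : ℕ) : μ.set a i v b = μ b := by
  simp [Mem.set, h]

@[simp] theorem Mem.set_set (μ : Mem) (a i v w : ℕ) : (μ.set a i v).set a i w = μ.set a i w := by
  simp [Mem.set]

/-- All numbers in the registers and in the memory have at most `L` bits. -/
structure Bdd (L : ℕ) (σ : State) : Prop where
  reg : ∀ r, σ.reg r < 2 ^ L
  mem : ∀ a i, σ.mem a i < 2 ^ L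

theorem Bdd.setReg {L : ℕ} {σ : State} (h : Bdd L σ) {x v : ℕ} (hv : v < 2 ^ L) :
    Bdd L (σ.setReg x v) := by
  refine ⟨fun r => ?_, h.mem⟩
  rw [State.reg_setReg]
  split_ifs
  exacts [hv, h.reg r]

theorem Bdd.setMem {L : ℕ} {σ : State} (h : Bdd L σ) {a i v : ℕ} (hv : v < 2 ^ L) :
    Bdd L (σ.setMem a i v) := by
  refine ⟨h.reg, fun b j => ?_⟩
  rw [State.mem_setMem, Mem.set_apply]
  split_ifs
  exacts [hv, h.mem b j]

theorem bdd_start (L : ℕ) : Bdd L (start []) :=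
  ⟨fun r => by simp [start], fun a i => by simp [start]⟩

/-- Weakest precondition with a budget of `N` operations on numbers of at most `L` bits: started in
`σ`, provided that `σ` is bounded, the program halts within this budget in a bounded state that
satisfies `Q`. An operation handles at most three numbers, whence the factor `3 * L + 1`. -/
def WP (inp : ℕ → ℕ → ℕ) (L : ℕ) (p : Prog) (σ : State) (N : ℕ) (Q : State → Prop) : Prop :=
  Bdd L σ → ∃ t σ', Runs inp p σ t σ' ∧ t ≤ N * (3 * L + 1) ∧ Bdd L σ' ∧ Q σ'

namespace WP

variable {inp : ℕ → ℕ → ℕ} {L : ℕ} {p q : Prog} {σ : State} {N N' : ℕ} {Q Q' : State → Prop}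

theorem mono (h : WP inp L p σ N Q) (hN : N ≤ N') : WP inp L p σ N' Q := by
  intro hb
  obtain ⟨t, σ', h1, h2, h3⟩ := h hb
  exact ⟨t, σ', h1, h2.trans (Nat.mul_le_mul_right _ hN), h3⟩

theorem imp (h : WP inp L p σ N Q) (hQ : ∀ σ', Q σ' → Q' σ') : WP inp L p σ N Q' := by
  intro hb
  obtain ⟨t, σ', h1, h2, h3, h4⟩ := h hb
  exact ⟨t, σ', h1, h2, h3, hQ _ h4⟩

theorem of_bdd (h : Bdd L σ → WP inp L p σ N Q) : WP inp L p σ N Q := fun hb => h hb hb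

theorem seq (h : WP inp L p σ N fun σ' => WP inp L q σ' N' Q) :
    WP inp L (p ;; q) σ (N + N') Q := by
  intro hb
  obtain ⟨t, σ', h1, h2, h3, h4⟩ := h hb
  obtain ⟨t', σ'', k1, k2, k3⟩ := h4 h3
  exact ⟨_, _, .seq h1 k1, by rw [add_mul]; exact add_le_add h2 k2, k3⟩

theorem skip (h : Q σ) : WP inp L .skip σ 1 Q :=
  fun hb => ⟨_, _, .skip σ, by omega, hb, h⟩

theorem const {x v : ℕ} (hv : v < 2 ^ L) (h : Q (σ.setReg x v)) :
    WP inp L (.const x v) σ 1 Q := by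
  intro hb
  refine ⟨_, _, .const σ x v, ?_, hb.setReg hv, h⟩
  have := Nat.size_le.2 hv
  omega

theorem op {o : Op} {x y z : ℕ} (v : ℕ) (hv : o.eval (σ.reg y) (σ.reg z) = v)
    (hL : v < 2 ^ L) (h : Q (σ.setReg x v)) : WP inp L (.op o x y z) σ 1 Q := by
  intro hb
  subst hv
  refine ⟨_, _, .op σ o x y z, ?_, hb.setReg hL, h⟩
  have := Nat.size_le.2 hL
  have := Nat.size_le.2 (hb.reg y)
  have := Nat.size_le.2 (hb.reg z)
  omega

theorem sub {x y z : ℕ} (v : ℕ) (hv : σ.reg y - σ.reg z = v) (h : Q (σ.setReg x v)) :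
    WP inp L (.op .sub x y z) σ 1 Q :=
  of_bdd fun hb => op v hv (by rw [← hv]; exact (Nat.sub_le _ _).trans_lt (hb.reg y)) h

theorem div {x y z : ℕ} (v : ℕ) (hv : σ.reg y / σ.reg z = v) (h : Q (σ.setReg x v)) :
    WP inp L (.op .div x y z) σ 1 Q :=
  of_bdd fun hb => op v hv (by rw [← hv]; exact (Nat.div_le_self _ _).trans_lt (hb.reg y)) h

theorem input {x y z : ℕ} (v : ℕ) (hv : inp (σ.reg y) (σ.reg z) = v)
    (hL : v < 2 ^ L) (h : Q (σ.setReg x v)) : WP inp L (.input x y z) σ 1 Q := by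
  intro hb
  subst hv
  refine ⟨_, _, .input σ x y z, ?_, hb.setReg hL, h⟩
  have := Nat.size_le.2 hL
  have := Nat.size_le.2 (hb.reg y)
  have := Nat.size_le.2 (hb.reg z)
  omega

theorem load {x y z : ℕ} (v : ℕ) (hv : σ.mem (σ.reg y) (σ.reg z) = v)
    (h : Q (σ.setReg x v)) : WP inp L (.load x y z) σ 1 Q := by
  intro hb
  have hL := hb.mem (σ.reg y) (σ.reg z)
  subst hv
  refine ⟨_, _, .load σ x y z, ?_, hb.setReg hL, h⟩
  have := Nat.size_le.2 hL
  have := Nat.size_le.2 (hb.reg y)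
  have := Nat.size_le.2 (hb.reg z)
  omega

theorem store {x y z : ℕ} (a i v : ℕ) (ha : σ.reg y = a) (hi : σ.reg z = i)
    (hv : σ.reg x = v) (h : Q (σ.setMem a i v)) : WP inp L (.store y z x) σ 1 Q := by
  intro hb
  subst ha hi hv
  refine ⟨_, _, .store σ y z x, ?_, hb.setMem (hb.reg x), h⟩
  have := Nat.size_le.2 (hb.reg x)
  have := Nat.size_le.2 (hb.reg y)
  have := Nat.size_le.2 (hb.reg z)
  omega

theorem ite {x : ℕ} (h₁ : σ.reg x ≠ 0 → WP inp L p σ N Q)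
    (h₂ : σ.reg x = 0 → WP inp L q σ N' Q) : WP inp L (.ite x p q) σ (1 + N + N') Q := by
  intro hb
  by_cases h : σ.reg x = 0
  · obtain ⟨t, σ', r1, r2, r3⟩ := h₂ h hb
    refine ⟨_, σ', .ite_false h r1, ?_, r3⟩
    rw [add_mul, add_mul]
    have := Nat.zero_le (N * (3 * L + 1))
    omega
  · obtain ⟨t, σ', r1, r2, r3⟩ := h₁ h hb
    refine ⟨_, σ', .ite_true h r1, ?_, r3⟩
    rw [add_mul, add_mul]
    have := Nat.zero_le (N' * (3 * L + 1))
    have := Nat.size_le.2 (hb.reg x)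
    omega

theorem loop_false {x : ℕ} (hx : σ.reg x = 0) (h : Q σ) : WP inp L (.loop x p) σ 1 Q :=
  fun hb => ⟨_, _, .loop_false hx, by omega, hb, h⟩

theorem loop_true {x : ℕ} (hx : σ.reg x ≠ 0)
    (h : WP inp L p σ N fun σ' => WP inp L (.loop x p) σ' N' Q) :
    WP inp L (.loop x p) σ (1 + N + N') Q := by
  intro hb
  obtain ⟨t, σ', h1, h2, h3, h4⟩ := h hb
  obtain ⟨t', σ'', k1, k2, k3⟩ := h4 h3
  refine ⟨_, _, .loop_true hx h1 k1, ?_, k3⟩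
  have := Nat.size_le.2 (hb.reg x)
  rw [add_mul, add_mul]
  omega

/-- A loop whose counter `x` is decremented by its body is executed as often as `x` says. -/
theorem loop_of_countdown {x : ℕ} (Inv : ℕ → State → Prop)
    (step : ∀ r σ, σ.reg x = r + 1 → Inv (r + 1) σ →
      WP inp L p σ N fun σ' => σ'.reg x = r ∧ Inv r σ')
    {n : ℕ} (hx : σ.reg x = n) (h : Inv n σ) :
    WP inp L (.loop x p) σ (n * (N + 1) + 1) (Inv 0) := by
  induction n generalizing σ with
  | zero => exact (loop_false hx h).mono (by omega)
  | succ n ih =>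
    refine (loop_true (N' := n * (N + 1) + 1) (by omega) ((step n σ hx h).imp ?_)).mono (by
      rw [add_mul]; omega)
    rintro σ' ⟨hx', h'⟩
    exact ih hx' h'

end WP

/-! ## Expressions and commands -/

/-- An arithmetic expression, compiled to a program. Registers below a depth `b` hold the values of
variables, the others are free; the code at depth `b` leaves the value of the expression in the
register `b`, using `cost` operations. -/
structure Expr where
  code : ℕ → Prog
  cost : ℕ

namespace Expr

/-- The literal `n`. -/
def lit (n : ℕ) : Expr := ⟨fun b => .const b n, 1⟩

/-- The variable kept in the register `x`. -/
def var (x : ℕ) : Expr := ⟨fun b => .const b 0 ;; .op .add b b x, 2⟩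

/-- The expression that combines the values of `e` and `f` by `m` operations `instr`. -/
def binary (m : ℕ) (instr : ℕ → Prog) (e f : Expr) : Expr :=
  ⟨fun b => e.code b ;; f.code (b + 1) ;; instr b, e.cost + f.cost + m⟩

/-- The expression `memory[e][f]`. -/
def load : Expr → Expr → Expr := binary 1 fun b => .load b b (b + 1)

/-- The expression `input[e][f]`. -/
def input : Expr → Expr → Expr := binary 1 fun b => .input b b (b + 1)

instance (n : ℕ) : OfNat Expr n := ⟨lit (OfNat.ofNat n)⟩
instance : Add Expr := ⟨binary 1 fun b => .op .add b b (b + 1)⟩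
instance : Sub Expr := ⟨binary 1 fun b => .op .sub b b (b + 1)⟩
instance : Mul Expr := ⟨binary 1 fun b => .op .mul b b (b + 1)⟩
instance : Div Expr := ⟨binary 1 fun b => .op .div b b (b + 1)⟩
instance : Mod Expr := ⟨binary 3 fun b =>
  .op .div (b + 2) b (b + 1) ;; .op .mul (b + 1) (b + 2) (b + 1) ;; .op .sub b b (b + 1)⟩

variable (e f : Expr)

@[simp] theorem cost_lit (n : ℕ) : (lit n).cost = 1 := rfl
@[simp] theorem cost_ofNat (n : ℕ) : (ofNat(n) : Expr).cost = 1 := rfl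
@[simp] theorem cost_var (x : ℕ) : (var x).cost = 2 := rfl
@[simp] theorem cost_load : (load e f).cost = e.cost + f.cost + 1 := rfl
@[simp] theorem cost_add : (e + f).cost = e.cost + f.cost + 1 := rfl
@[simp] theorem cost_sub : (e - f).cost = e.cost + f.cost + 1 := rfl
@[simp] theorem cost_mul : (e * f).cost = e.cost + f.cost + 1 := rfl
@[simp] theorem cost_div : (e / f).cost = e.cost + f.cost + 1 := rfl
@[simp] theorem cost_mod : (e % f).cost = e.cost + f.cost + 3 := rfl

end Expr

/-- `σ'` results from `σ` by putting `v` into the register `b` and scratch values above it. -/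
structure Yields (b v : ℕ) (σ σ' : State) : Prop where
  mem : σ'.mem = σ.mem
  reg : σ'.reg b = v
  low : ∀ x < b, σ'.reg x = σ.reg x

theorem Yields.setReg (b v : ℕ) (σ : State) : Yields b v σ (σ.setReg b v) :=
  ⟨rfl, by simp, fun x hx => by simp [hx.ne]⟩

/-- The variables in scope at a point of a program with input `inp` that handles numbers of at most
`L` bits: the registers below `depth`, with the values `env`. All other data of a structured program
is in the memory. -/
structure Scope (inp : ℕ → ℕ → ℕ) (L : ℕ) where
  depth : ℕ
  env : ℕ → ℕ

namespace Scope

variable {inp : ℕ → ℕ → ℕ} {L : ℕ} {Γ Γ' : Scope inp L} {μ : Mem} {e f : Expr} {u v : ℕ}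

instance : Preorder (Scope inp L) where
  le Γ Γ' := Γ.depth ≤ Γ'.depth ∧ ∀ x < Γ.depth, Γ'.env x = Γ.env x
  le_refl _ := ⟨le_rfl, fun _ _ => rfl⟩
  le_trans _ _ _ h h' :=
    ⟨h.1.trans h'.1, fun x hx => (h'.2 x (hx.trans_le h.1)).trans (h.2 x hx)⟩

/-- The registers of `σ` hold the values of the variables. -/
def Models (Γ : Scope inp L) (σ : State) : Prop := ∀ x < Γ.depth, σ.reg x = Γ.env x

theorem Models.anti {σ : State} (h : Γ'.Models σ) (hΓ : Γ ≤ Γ') : Γ.Models σ :=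
  fun x hx => (h x (hx.trans_le hΓ.1)).trans (hΓ.2 x hx)

theorem Models.of_yields {b : ℕ} {σ σ' : State} (hσ : Γ.Models σ) (h : Yields b v σ σ')
    (hb : Γ.depth ≤ b) : Γ.Models σ' :=
  fun x hx => (h.low x (hx.trans_le hb)).trans (hσ x hx)

/-- In the memory `μ`, the expression `e` has the value `v`. -/
def Evals (Γ : Scope inp L) (μ : Mem) (e : Expr) (v : ℕ) : Prop :=
  ∀ b ≥ Γ.depth, ∀ σ, Γ.Models σ → σ.mem = μ → WP inp L (e.code b) σ e.cost (Yields b v σ)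

namespace Evals

theorem mono (h : Γ.Evals μ e v) (hΓ : Γ ≤ Γ') : Γ'.Evals μ e v :=
  fun b hb σ hσ => h b (hΓ.1.trans hb) σ (hσ.anti hΓ)

theorem lit {n : ℕ} (hn : n < 2 ^ L) : Γ.Evals μ (.lit n) n :=
  fun b _ σ _ _ => .const hn (.setReg b n σ)

theorem var {x : ℕ} (hx : x < Γ.depth) : Γ.Evals μ (.var x) (Γ.env x) := by
  intro b hb σ hσ _
  refine .of_bdd fun hbd => .seq (.const (by positivity) (.op (Γ.env x) ?_ (hσ x hx ▸ hbd.reg x)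
    ⟨rfl, by simp, fun y hy => by simp [hy.ne]⟩))
  simp [Op.eval, hσ x hx, (hx.trans_le hb).ne]

theorem binary {m w : ℕ} {instr : ℕ → Prog} (he : Γ.Evals μ e u) (hf : Γ.Evals μ f v)
    (h : ∀ b σ, σ.mem = μ → σ.reg b = u → σ.reg (b + 1) = v →
      WP inp L (instr b) σ m (Yields b w σ)) :
    Γ.Evals μ (.binary m instr e f) w := by
  intro b hb σ hσ hμ
  refine (WP.seq ((he b hb σ hσ hμ).imp fun σ₁ h₁ =>
    .seq ((hf (b + 1) (by omega) σ₁ (hσ.of_yields h₁ hb) (h₁.mem.trans hμ)).imp fun σ₂ h₂ =>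
      (h b σ₂ (h₂.mem.trans (h₁.mem.trans hμ)) ((h₂.low b (by omega)).trans h₁.reg) h₂.reg).imp
        fun σ₃ h₃ => ⟨by rw [h₃.mem, h₂.mem, h₁.mem], h₃.reg, fun x hx => ?_⟩))).mono
    (by simp only [Expr.binary]; omega)
  rw [h₃.low x hx, h₂.low x (by omega), h₁.low x hx]

theorem load (he : Γ.Evals μ e u) (hf : Γ.Evals μ f v) : Γ.Evals μ (.load e f) (μ u v) :=
  he.binary hf fun b σ hμ hu hv => .load _ (by rw [hμ, hu, hv]) (.setReg ..)

theorem input (he : Γ.Evals μ e u) (hf : Γ.Evals μ f v) (h : inp u v < 2 ^ L) :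
    Γ.Evals μ (.input e f) (inp u v) :=
  he.binary hf fun b σ _ hu hv => .input _ (by rw [hu, hv]) h (.setReg ..)

theorem add (he : Γ.Evals μ e u) (hf : Γ.Evals μ f v) (h : u + v < 2 ^ L) :
    Γ.Evals μ (e + f) (u + v) :=
  he.binary hf fun b σ _ hu hv => .op _ (by rw [hu, hv]; rfl) h (.setReg ..)

theorem mul (he : Γ.Evals μ e u) (hf : Γ.Evals μ f v) (h : u * v < 2 ^ L) :
    Γ.Evals μ (e * f) (u * v) :=
  he.binary hf fun b σ _ hu hv => .op _ (by rw [hu, hv]; rfl) h (.setReg ..)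

theorem sub (he : Γ.Evals μ e u) (hf : Γ.Evals μ f v) : Γ.Evals μ (e - f) (u - v) :=
  he.binary hf fun b σ _ hu hv => .sub _ (by rw [hu, hv]) (.setReg ..)

theorem div (he : Γ.Evals μ e u) (hf : Γ.Evals μ f v) : Γ.Evals μ (e / f) (u / v) :=
  he.binary hf fun b σ _ hu hv => .div _ (by rw [hu, hv]) (.setReg ..)

theorem mod (he : Γ.Evals μ e u) (hf : Γ.Evals μ f v) : Γ.Evals μ (e % f) (u % v) := by
  refine he.binary hf fun b σ _ hu hv => .of_bdd fun hbd => ?_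
  have hlt : u / v * v < 2 ^ L := (Nat.div_mul_le_self u v).trans_lt (hu ▸ hbd.reg b)
  refine WP.seq (N := 1) (.div (u / v) (by rw [hu, hv]) (.seq (N := 1) (N' := 1)
    (.op (u / v * v) (by simp [Op.eval, hv]) hlt (.sub (u % v) ?_ ⟨rfl, by simp, fun x hx => ?_⟩))))
  · simp [hu, Nat.mod_eq_sub_div_mul]
  · have h1 : x ≠ b + 1 := by omega
    have h2 : x ≠ b + 2 := by omega
    simp [hx.ne, h1, h2]

end Evals

end Scope

/-- A command, compiled to a program for each depth; it must not change the registers below it. -/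
def Cmd := ℕ → Prog

namespace Cmd

/-- The command `memory[a][i] := e`. -/
def store (a i e : Expr) : Cmd := fun d =>
  a.code d ;; i.code (d + 1) ;; e.code (d + 2) ;; .store d (d + 1) (d + 2)

/-- Sequential composition. -/
def seq (p q : Cmd) : Cmd := fun d => p d ;; q d

/-- The command that executes `p` unless the value of `e` is zero. -/
def onlyIf (e : Expr) (p : Cmd) : Cmd := fun d => e.code d ;; .ite d (p d) .skip

/-- The loop `for i := 0, …, lim - 1 do body i`. -/
def forTo (lim : Expr) (body : Expr → Cmd) : Cmd := fun d =>
  .const d 0 ;; lim.code (d + 1) ;; .loop (d + 1)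
    (body (.var d) (d + 2) ;; .const (d + 2) 1 ;; .op .add d d (d + 2) ;;
      .op .sub (d + 1) (d + 1) (d + 2))

end Cmd

infixr:60 " ⨟ " => Cmd.seq

namespace Scope

variable {inp : ℕ → ℕ → ℕ} {L : ℕ}

/-- Started in the memory `μ`, the command `p` ends within `N` operations in a memory that satisfies
`Q`. -/
def Executes (Γ : Scope inp L) (μ : Mem) (p : Cmd) (N : ℕ) (Q : Mem → Prop) : Prop :=
  ∀ σ, Γ.Models σ → σ.mem = μ →
    WP inp L (p Γ.depth) σ N fun σ' => Γ.Models σ' ∧ Q σ'.mem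

/-- The scope of a loop body: the loop variable has the value `i`, and `r` rounds are left. -/
def push (Γ : Scope inp L) (i r : ℕ) : Scope inp L where
  depth := Γ.depth + 2
  env := Function.update (Function.update Γ.env Γ.depth i) (Γ.depth + 1) r

variable {Γ Γ' : Scope inp L} {μ : Mem} {p q : Cmd} {N N' : ℕ} {Q Q' : Mem → Prop}

theorem le_push (i r : ℕ) : Γ ≤ Γ.push i r := by
  refine ⟨Nat.le_add_right _ _, fun x hx => ?_⟩
  have h : x ≠ Γ.depth + 1 := by omega
  simp [push, hx.ne, h]

theorem models_push {i r : ℕ} {σ : State} :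
    (Γ.push i r).Models σ ↔ Γ.Models σ ∧ σ.reg Γ.depth = i ∧ σ.reg (Γ.depth + 1) = r := by
  refine ⟨fun h => ⟨h.anti (le_push i r), ?_, ?_⟩, fun ⟨h, hi, hr⟩ x hx => ?_⟩
  · rw [h _ (by simp [push])]; simp [push]
  · rw [h _ (by simp [push])]; simp [push]
  · have hx' : x < Γ.depth + 2 := hx
    obtain hlt | rfl | rfl : x < Γ.depth ∨ x = Γ.depth ∨ x = Γ.depth + 1 := by omega
    · rw [h x hlt, (le_push i r).2 x hlt]
    · simp [push, hi]
    · simp [push, hr]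

namespace Executes

theorem mono (h : Γ.Executes μ p N Q) (hN : N ≤ N') : Γ.Executes μ p N' Q :=
  fun σ hσ hμ => (h σ hσ hμ).mono hN

theorem imp (h : Γ.Executes μ p N Q) (hQ : ∀ μ', Q μ' → Q' μ') : Γ.Executes μ p N Q' :=
  fun σ hσ hμ => (h σ hσ hμ).imp fun _ h' => ⟨h'.1, hQ _ h'.2⟩

theorem seq (h : Γ.Executes μ p N fun μ' => Γ.Executes μ' q N' Q) :
    Γ.Executes μ (p ⨟ q) (N + N') Q :=
  fun σ hσ hμ => .seq ((h σ hσ hμ).imp fun _ h' => h'.2 _ h'.1 rfl)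

theorem store {a i e : Expr} {x y v : ℕ} (ha : Γ.Evals μ a x) (hi : Γ.Evals μ i y)
    (he : Γ.Evals μ e v) (h : Q (μ.set x y v)) :
    Γ.Executes μ (.store a i e) (a.cost + i.cost + e.cost + 1) Q := by
  intro σ hσ hμ
  refine (WP.seq ((ha Γ.depth le_rfl σ hσ hμ).imp fun σ₁ h₁ => ?_)).mono
    (N := a.cost + (i.cost + (e.cost + 1))) (by omega)
  have hσ₁ := hσ.of_yields h₁ le_rfl
  refine .seq ((hi (Γ.depth + 1) (by omega) σ₁ hσ₁ (h₁.mem.trans hμ)).imp fun σ₂ h₂ => ?_)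
  have hσ₂ := hσ₁.of_yields h₂ (by omega)
  have hμ₂ : σ₂.mem = μ := h₂.mem.trans (h₁.mem.trans hμ)
  refine .seq ((he (Γ.depth + 2) (by omega) σ₂ hσ₂ hμ₂).imp fun σ₃ h₃ => ?_)
  refine .store x y v ?_ ?_ h₃.reg ⟨fun z hz => ?_, ?_⟩
  · rw [h₃.low _ (by omega), h₂.low _ (by omega), h₁.reg]
  · rw [h₃.low _ (by omega), h₂.reg]
  · exact hσ₂.of_yields h₃ (by omega) z hz
  · rwa [State.mem_setMem, h₃.mem, hμ₂]

theorem onlyIf {e : Expr} {v : ℕ} (he : Γ.Evals μ e v) (h : v ≠ 0 → Γ.Executes μ p N Q)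
    (h₀ : v = 0 → Q μ) : Γ.Executes μ (.onlyIf e p) (e.cost + N + 2) Q := by
  intro σ hσ hμ
  refine (WP.seq ((he Γ.depth le_rfl σ hσ hμ).imp fun σ' h' => .ite (N := N) (N' := 1)
    (fun hv => ?_) fun hv => .skip ⟨hσ.of_yields h' le_rfl, ?_⟩)).mono (by omega)
  · exact h (h'.reg ▸ hv) σ' (hσ.of_yields h' le_rfl) (h'.mem.trans hμ)
  · rw [h'.mem, hμ]
    exact h₀ (h'.reg ▸ hv)

theorem forTo_step {body : Expr → Cmd} {i r : ℕ} {σ : State}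
    (h : (Γ.push i (r + 1)).Executes σ.mem (body (.var Γ.depth)) N Q)
    (hσ : (Γ.push i (r + 1)).Models σ) (hi : i + 1 < 2 ^ L) :
    WP inp L (body (.var Γ.depth) (Γ.depth + 2) ;; .const (Γ.depth + 2) 1 ;;
      .op .add Γ.depth Γ.depth (Γ.depth + 2) ;;
      .op .sub (Γ.depth + 1) (Γ.depth + 1) (Γ.depth + 2)) σ (N + 3)
      fun σ' => (Γ.push (i + 1) r).Models σ' ∧ Q σ'.mem := by
  refine WP.seq (N' := 3) ((h σ hσ rfl).imp fun σ₁ ⟨hσ₁, hQ⟩ => ?_)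
  obtain ⟨hΓ, hi₁, hr₁⟩ := models_push.1 hσ₁
  refine WP.seq (N := 1) (N' := 2) (.const (by omega) (.seq (N := 1) (N' := 1)
    (.op (i + 1) (by simp [Op.eval, hi₁]) hi (.sub r (by simp [hr₁]) ⟨?_, hQ⟩))))
  refine models_push.2 ⟨fun x hx => ?_, by simp, by simp⟩
  have h1 : x ≠ Γ.depth + 1 := by omega
  have h2 : x ≠ Γ.depth + 2 := by omega
  simp [hx.ne, h1, h2, hΓ x hx]

theorem forTo {lim : Expr} {body : Expr → Cmd} {n : ℕ} (Inv : ℕ → Mem → Prop)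
    (hlim : Γ.Evals μ lim n) (init : Inv 0 μ)
    (step : ∀ i < n, ∀ μ', Inv i μ' → ∀ Γ' ≥ Γ, ∀ x, (∀ μ, Γ'.Evals μ (.var x) i) →
      Γ'.Executes μ' (body (.var x)) N (Inv (i + 1))) :
    Γ.Executes μ (.forTo lim body) (n * (N + 4) + (lim.cost + 2)) (Inv n) := by
  intro σ hσ hμ
  set σ₀ := σ.setReg Γ.depth 0 with hσ₀
  have h₀ : Γ.Models σ₀ := fun x hx => by simp [hσ₀, hx.ne, hσ x hx]
  refine (WP.seq (N' := lim.cost + (n * (N + 3 + 1) + 1)) (.const (by positivity)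
    (.seq ((hlim (Γ.depth + 1) (by omega) σ₀ h₀ hμ).imp fun σ₁ h₁ => .of_bdd fun hbd => ?_)))).mono
    (by linarith)
  have hn : n < 2 ^ L := h₁.reg ▸ hbd.reg _
  refine (WP.loop_of_countdown
    (fun r τ => r ≤ n ∧ (Γ.push (n - r) r).Models τ ∧ Inv (n - r) τ.mem) ?_ h₁.reg
    ⟨le_rfl, models_push.2 ⟨h₀.of_yields h₁ (by omega), ?_, h₁.reg⟩, ?_⟩).imp
    fun τ ⟨_, hτ, hInv⟩ => ⟨hτ.anti (le_push _ _), hInv⟩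
  · rintro r τ - ⟨hr, hτ, hInv⟩
    have hi : n - (r + 1) + 1 = n - r := by omega
    refine (forTo_step (step (n - (r + 1)) (by omega) τ.mem hInv _ (le_push _ (r + 1)) Γ.depth
      fun μ => ?_) hτ (by omega)).imp fun τ' ⟨hτ', hInv'⟩ => ?_
    · convert Scope.Evals.var (μ := μ) (x := Γ.depth) _ using 1 <;> simp [push]
    · rw [hi] at hτ' hInv'
      exact ⟨(models_push.1 hτ').2.2, by omega, hτ', hInv'⟩
  · rw [h₁.low _ (by omega), hσ₀]; simp
  · rw [h₁.mem, hσ₀, State.mem_setReg, hμ]; simpa using init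

end Executes

end Scope

/-! ## Relocated programs -/

namespace Prog

/-- A strict upper bound of the registers named in a program. -/
def regBound : Prog → ℕ
  | .skip => 0
  | .const x _ => x + 1
  | .op _ x y z => max (x + 1) (max (y + 1) (z + 1))
  | .input x y z => max (x + 1) (max (y + 1) (z + 1))
  | .load x y z => max (x + 1) (max (y + 1) (z + 1))
  | .store y z x => max (x + 1) (max (y + 1) (z + 1))
  | .seq p q => max p.regBound q.regBound
  | .ite x p q => max (x + 1) (max p.regBound q.regBound)
  | .loop x p => max (x + 1) p.regBound

/-- Puts the array number `y * M + q` into the register `b + 2`, where `y` is the content of the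
register `b + 3 + r`, and `M` and `q` are those of the registers `b` and `b + 1`. -/
def relocateArray (b r : ℕ) : Prog :=
  .op .mul (b + 2) (b + 3 + r) b ;; .op .add (b + 2) (b + 2) (b + 1)

/-- The program with its registers shifted by `b + 3` and with its array `y` moved to the array
`y * M + q`, where `M` and `q` are the contents of the registers `b` and `b + 1`. -/
def relocate (b : ℕ) : Prog → Prog
  | .skip => .skip
  | .const x v => .const (b + 3 + x) v
  | .op o x y z => .op o (b + 3 + x) (b + 3 + y) (b + 3 + z)
  | .input x y z => .input (b + 3 + x) (b + 3 + y) (b + 3 + z)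
  | .load x y z => relocateArray b y ;; .load (b + 3 + x) (b + 2) (b + 3 + z)
  | .store y z x => relocateArray b y ;; .store (b + 2) (b + 3 + z) (b + 3 + x)
  | .seq p q => p.relocate b ;; q.relocate b
  | .ite x p q => .ite (b + 3 + x) (p.relocate b) (q.relocate b)
  | .loop x p => .loop (b + 3 + x) (p.relocate b)

end Prog

/-- The state `τ` of a relocated program represents the state `σ` of the original one, as far as the
registers below `R` are concerned. -/
structure Represents (b M q R : ℕ) (σ τ : State) : Prop where
  modulus : τ.reg b = M
  residue : τ.reg (b + 1) = q
  reg : ∀ r < R, τ.reg (b + 3 + r) = σ.reg r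
  mem : ∀ y, τ.mem (y * M + q) = σ.mem y

/-- What a relocated program leaves unchanged. -/
structure RelocateFrame (b M q : ℕ) (τ τ' : State) : Prop where
  reg : ∀ r < b, τ'.reg r = τ.reg r
  mem : ∀ a, a % M ≠ q → τ'.mem a = τ.mem a

theorem RelocateFrame.refl {b M q : ℕ} (τ : State) : RelocateFrame b M q τ τ :=
  ⟨fun _ _ => rfl, fun _ _ => rfl⟩

theorem RelocateFrame.trans {b M q : ℕ} {τ τ' τ'' : State} (h : RelocateFrame b M q τ τ')
    (h' : RelocateFrame b M q τ' τ'') : RelocateFrame b M q τ τ'' :=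
  ⟨fun r hr => (h'.reg r hr).trans (h.reg r hr), fun a ha => (h'.mem a ha).trans (h.mem a ha)⟩

theorem RelocateFrame.setReg {b M q x v : ℕ} {τ : State} (hx : b ≤ x) :
    RelocateFrame b M q τ (τ.setReg x v) :=
  ⟨fun r hr => by simp [(hr.trans_le hx).ne], fun _ _ => rfl⟩

theorem RelocateFrame.setMem {b M q y i v : ℕ} {τ : State} (hq : q < M) :
    RelocateFrame b M q τ (τ.setMem (y * M + q) i v) := by
  refine ⟨fun _ _ => rfl, fun a ha => Mem.set_of_ne _ ?_ _ _⟩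
  rintro rfl
  exact ha (by rw [Nat.mul_add_mod_self_right, Nat.mod_eq_of_lt hq])

section Relocate

variable {inp : ℕ → ℕ → ℕ} {L B b M q R : ℕ} {σ τ : State}

namespace Represents

theorem setReg (h : Represents b M q R σ τ) (x v : ℕ) :
    Represents b M q R (σ.setReg x v) (τ.setReg (b + 3 + x) v) := by
  have h0 : b ≠ b + 3 + x := by omega
  have h1 : b + 1 ≠ b + 3 + x := by omega
  exact ⟨by simp [h0, h.modulus], by simp [h1, h.residue],
    fun r hr => by simp [h.reg r hr], h.mem⟩

theorem setScratch (h : Represents b M q R σ τ) (v : ℕ) :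
    Represents b M q R σ (τ.setReg (b + 2) v) := by
  refine ⟨by simp [h.modulus], by simp [h.residue], fun r hr => ?_, h.mem⟩
  have h2 : b + 3 + r ≠ b + 2 := by omega
  simp [h2, h.reg r hr]

theorem setMem (h : Represents b M q R σ τ) (hM : 0 < M) (y i v : ℕ) :
    Represents b M q R (σ.setMem y i v) (τ.setMem (y * M + q) i v) := by
  refine ⟨h.modulus, h.residue, h.reg, fun z => ?_⟩
  funext j
  simp [Mem.set_apply, h.mem, hM.ne']

end Represents

theorem wp_relocateArray {y : ℕ} (h : Represents b M q R σ τ) (hq : q < M)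
    (hL : 2 ^ B * M ≤ 2 ^ L) (hyR : y < R) (hy : (σ.reg y).size ≤ B) :
    WP inp L (Prog.relocateArray b y) τ 2 fun τ' => Represents b M q R σ τ' ∧
      RelocateFrame b M q τ τ' ∧ τ'.reg (b + 2) = σ.reg y * M + q := by
  have hlt : σ.reg y * M + q < 2 ^ L := calc
    σ.reg y * M + q < (σ.reg y + 1) * M := by rw [add_mul]; omega
    _ ≤ 2 ^ B * M := Nat.mul_le_mul_right _ (Nat.size_le.1 hy)
    _ ≤ 2 ^ L := hL
  exact WP.seq (N := 1) (N' := 1) (.op (σ.reg y * M) (by simp [Op.eval, h.reg y hyR, h.modulus])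
    (by omega) (.op _ (by simp [Op.eval, h.residue]) hlt ⟨(h.setScratch _).setScratch _,
      .trans (.setReg (by omega)) (.setReg (by omega)), by simp⟩))

theorem wp_relocate_load {x y z : ℕ} (h : Represents b M q R σ τ) (hq : q < M)
    (hL : 2 ^ B * M ≤ 2 ^ L) (hyR : y < R) (hzR : z < R) (hy : (σ.reg y).size ≤ B) :
    WP inp L ((Prog.load x y z).relocate b) τ 3 fun τ' =>
      Represents b M q R (σ.setReg x (σ.mem (σ.reg y) (σ.reg z))) τ' ∧ RelocateFrame b M q τ τ' :=
  .seq (N' := 1) ((wp_relocateArray h hq hL hyR hy).imp fun _ ⟨h', hf, ha⟩ =>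
    .load _ (by rw [ha, h'.reg z hzR, h'.mem]) ⟨h'.setReg x _, hf.trans (.setReg (by omega))⟩)

theorem wp_relocate_store {x y z : ℕ} (h : Represents b M q R σ τ) (hq : q < M)
    (hL : 2 ^ B * M ≤ 2 ^ L) (hxR : x < R) (hyR : y < R) (hzR : z < R)
    (hy : (σ.reg y).size ≤ B) :
    WP inp L ((Prog.store y z x).relocate b) τ 3 fun τ' =>
      Represents b M q R (σ.setMem (σ.reg y) (σ.reg z) (σ.reg x)) τ' ∧
        RelocateFrame b M q τ τ' :=
  .seq (N' := 1) ((wp_relocateArray h hq hL hyR hy).imp fun _ ⟨h', hf, ha⟩ =>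
    .store _ _ _ ha (h'.reg z hzR) (h'.reg x hxR)
      ⟨h'.setMem (by omega) _ _ _, hf.trans (.setMem hq)⟩)

theorem wp_relocate {t : ℕ} {p : Prog} {σ' : State} (hrun : Runs inp p σ t σ')
    (h : Represents b M q R σ τ) (hq : q < M) (hL : 2 ^ B * M ≤ 2 ^ L) (ht : t ≤ B)
    (hR : p.regBound ≤ R) :
    WP inp L (p.relocate b) τ (3 * t) fun τ' =>
      Represents b M q R σ' τ' ∧ RelocateFrame b M q τ τ' := by
  have hM : 0 < M := by omega
  have small (v : ℕ) (hv : v.size ≤ B) : v < 2 ^ L :=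
    (Nat.size_le.1 hv).trans_le ((Nat.le_mul_of_pos_right _ hM).trans hL)
  induction hrun generalizing τ with
  | skip σ => exact (WP.skip ⟨h, .refl τ⟩).mono (by omega)
  | const σ x v =>
    exact (WP.const (small v (by omega)) ⟨h.setReg x v, .setReg (by omega)⟩).mono (by omega)
  | op σ o x y z =>
    simp only [Prog.regBound, sup_le_iff] at hR
    exact (WP.op _ (by rw [h.reg y (by omega), h.reg z (by omega)]) (small _ (by omega))
      ⟨h.setReg x _, .setReg (by omega)⟩).mono (by omega)
  | input σ x y z =>
    simp only [Prog.regBound, sup_le_iff] at hR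
    exact (WP.input _ (by rw [h.reg y (by omega), h.reg z (by omega)]) (small _ (by omega))
      ⟨h.setReg x _, .setReg (by omega)⟩).mono (by omega)
  | load σ x y z =>
    simp only [Prog.regBound, sup_le_iff] at hR
    exact (wp_relocate_load h hq hL (by omega) (by omega) (by omega)).mono (by omega)
  | store σ y z x =>
    simp only [Prog.regBound, sup_le_iff] at hR
    exact (wp_relocate_store h hq hL (by omega) (by omega) (by omega) (by omega)).mono (by omega)
  | @seq _ _ _ _ _ t t' _ _ ih ih' =>
    simp only [Prog.regBound, sup_le_iff] at hR
    exact (WP.seq (N' := 3 * t') ((ih h (by omega) hR.1).imp fun τ₁ ⟨h₁, hf₁⟩ =>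
      (ih' h₁ (by omega) hR.2).imp fun τ₂ ⟨h₂, hf₂⟩ => ⟨h₂, hf₁.trans hf₂⟩)).mono (by omega)
  | ite_true hx _ ih =>
    simp only [Prog.regBound, sup_le_iff] at hR
    rw [← h.reg _ (by omega)] at hx
    exact (WP.ite (N' := 0) (fun _ => ih h (by omega) hR.2.1) fun h0 => absurd h0 hx).mono
      (by omega)
  | ite_false hx _ ih =>
    simp only [Prog.regBound, sup_le_iff] at hR
    rw [← h.reg _ (by omega)] at hx
    exact (WP.ite (N := 0) (fun h0 => absurd hx h0) fun _ => ih h (by omega) hR.2.2).mono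
      (by omega)
  | @loop_true _ _ _ _ _ t t' hx _ _ ih ih' =>
    have hR' := hR
    simp only [Prog.regBound, sup_le_iff] at hR'
    rw [← h.reg _ (by omega)] at hx
    exact (WP.loop_true (N' := 3 * t') hx ((ih h (by omega) hR'.2).imp fun τ₁ ⟨h₁, hf₁⟩ =>
      (ih' h₁ (by omega) hR).imp fun τ₂ ⟨h₂, hf₂⟩ => ⟨h₂, hf₁.trans hf₂⟩)).mono (by omega)
  | loop_false hx =>
    simp only [Prog.regBound, sup_le_iff] at hR
    rw [← h.reg _ (by omega)] at hx
    exact (WP.loop_false hx ⟨h, .refl τ⟩).mono (by omega)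

end Relocate

/-- Sets the registers `b, …, b + R - 1` to zero. -/
def clear (b : ℕ) : ℕ → Prog
  | 0 => .skip
  | R + 1 => clear b R ;; .const (b + R) 0

theorem wp_clear {inp : ℕ → ℕ → ℕ} {L : ℕ} (b R : ℕ) (σ : State) :
    WP inp L (clear b R) σ (R + 1) fun σ' => σ'.mem = σ.mem ∧
      (∀ r < b, σ'.reg r = σ.reg r) ∧ ∀ r < R, σ'.reg (b + r) = 0 := by
  induction R with
  | zero => exact .skip ⟨rfl, fun _ _ => rfl, fun r hr => absurd hr (by omega)⟩
  | succ R ih =>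
    refine .seq (ih.imp fun σ' ⟨hm, hlow, hz⟩ => .const (by positivity) ⟨hm, fun r hr => ?_,
      fun r hr => ?_⟩)
    · rw [State.reg_setReg, if_neg (by omega), hlow r hr]
    · rw [State.reg_setReg]
      split_ifs with h
      exacts [rfl, hz r (by omega)]

/-- Prepares, at the depth `d`, a relocated run of a program with at most `R + 2` registers: the
modulus `M`, the residue `q`, and the arguments `e` and `f`. -/
def setArguments (M q e f : Expr) (R d : ℕ) : Prog :=
  M.code d ;; q.code (d + 1) ;; e.code (d + 3) ;; f.code (d + 4) ;; clear (d + 5) R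

/-- The command `memory[a][i] := E(e, f)`, which runs `E` on the arguments `e` and `f` in those
arrays whose numbers are congruent to `q` modulo `M`. -/
def Cmd.call (E : Prog) (M q e f a i : Expr) : Cmd := fun d =>
  setArguments M q e f E.regBound d ;; E.relocate d ;;
    a.code (d + 4) ;; i.code (d + 5) ;; .store (d + 4) (d + 5) (d + 3)

namespace Scope

variable {inp : ℕ → ℕ → ℕ} {L : ℕ} {Γ : Scope inp L} {μ : Mem} {M q e f a i : Expr}
  {B m r x y : ℕ}

theorem wp_setArguments {R : ℕ} {σ : State} (hM : Γ.Evals μ M m) (hq : Γ.Evals μ q r)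
    (he : Γ.Evals μ e x) (hf : Γ.Evals μ f y) (hr : r < m) (hμ : ∀ b, b % m = r → μ b = 0)
    (hσ : Γ.Models σ) (hmem : σ.mem = μ) :
    WP inp L (setArguments M q e f R Γ.depth) σ (M.cost + q.cost + e.cost + f.cost + R + 1)
      fun σ' => Γ.Models σ' ∧ σ'.mem = μ ∧
        Represents Γ.depth m r (R + 2) (start [x, y]) σ' := by
  set d := Γ.depth
  refine (WP.seq ((hM d le_rfl σ hσ hmem).imp fun σ₁ h₁ => ?_)).mono
    (N := M.cost + (q.cost + (e.cost + (f.cost + (R + 1))))) (by omega)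
  have hσ₁ := hσ.of_yields h₁ le_rfl
  refine .seq ((hq (d + 1) (by omega) σ₁ hσ₁ (h₁.mem.trans hmem)).imp fun σ₂ h₂ => ?_)
  have hσ₂ := hσ₁.of_yields h₂ (by omega)
  refine .seq ((he (d + 3) (by omega) σ₂ hσ₂
    (h₂.mem.trans (h₁.mem.trans hmem))).imp fun σ₃ h₃ => ?_)
  have hσ₃ := hσ₂.of_yields h₃ (by omega)
  refine .seq ((hf (d + 4) (by omega) σ₃ hσ₃
    (h₃.mem.trans (h₂.mem.trans (h₁.mem.trans hmem)))).imp fun σ₄ h₄ => ?_)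
  have hσ₄ := hσ₃.of_yields h₄ (by omega)
  refine (wp_clear (d + 5) R σ₄).imp fun σ₅ ⟨hmem₅, hlow₅, hzero₅⟩ => ?_
  have hmem₅ : σ₅.mem = μ := by rw [hmem₅, h₄.mem, h₃.mem, h₂.mem, h₁.mem, hmem]
  refine ⟨fun s hs => by rw [hlow₅ s (by omega), hσ₄ s hs], hmem₅, ?_, ?_, fun s hs => ?_,
    fun b => ?_⟩
  · rw [hlow₅ _ (by omega), h₄.low _ (by omega), h₃.low _ (by omega), h₂.low _ (by omega), h₁.reg]
  · rw [hlow₅ _ (by omega), h₄.low _ (by omega), h₃.low _ (by omega), h₂.reg]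
  · obtain _ | _ | s := s
    · rw [hlow₅ _ (by omega), h₄.low _ (by omega)]; exact h₃.reg
    · rw [hlow₅ _ (by omega)]; exact h₄.reg
    · rw [show d + 3 + (s + 1 + 1) = d + 5 + s by omega, hzero₅ s (by omega)]; rfl
  · rw [hmem₅, hμ _ (by rw [Nat.mul_add_mod_self_right, Nat.mod_eq_of_lt hr])]; rfl

theorem Executes.call {E : Prog} {t a₀ i₀ : ℕ} {σ' : State}
    (hrun : Runs inp E (start [x, y]) t σ') (ht : t ≤ B) (hr : r < m) (hL : 2 ^ B * m ≤ 2 ^ L)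
    (hM : Γ.Evals μ M m) (hq : Γ.Evals μ q r) (he : Γ.Evals μ e x) (hf : Γ.Evals μ f y)
    (ha : ∀ μ, Γ.Evals μ a a₀) (hi : ∀ μ, Γ.Evals μ i i₀) (hμ : ∀ b, b % m = r → μ b = 0) :
    Γ.Executes μ (.call E M q e f a i)
      (M.cost + q.cost + e.cost + f.cost + E.regBound + 3 * B + a.cost + i.cost + 2)
      fun μ' => ∃ μ₁ : Mem, (∀ b, b % m ≠ r → μ₁ b = μ b) ∧ μ' = μ₁.set a₀ i₀ (σ'.reg 0) := by
  intro σ hσ hmem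
  refine (WP.seq (N' := 3 * B + (a.cost + (i.cost + 1)))
    ((wp_setArguments hM hq he hf hr hμ hσ hmem).imp fun σ₁ ⟨hσ₁, hmem₁, hrep⟩ => ?_)).mono
    (by omega)
  refine .seq (((wp_relocate hrun hrep hr hL ht le_self_add).mono (Nat.mul_le_mul_left 3 ht)).imp
    fun σ₂ ⟨hrep₂, hframe⟩ => ?_)
  have hσ₂ : Γ.Models σ₂ := fun s hs => by rw [hframe.reg s hs, hσ₁ s hs]
  refine .seq ((ha _ (Γ.depth + 4) (by omega) σ₂ hσ₂ rfl).imp fun σ₃ h₃ => ?_)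
  have hσ₃ := hσ₂.of_yields h₃ (by omega)
  refine .seq ((hi _ (Γ.depth + 5) (by omega) σ₃ hσ₃ rfl).imp fun σ₄ h₄ => ?_)
  have hσ₄ := hσ₃.of_yields h₄ (by omega)
  refine .store a₀ i₀ (σ'.reg 0) ?_ h₄.reg ?_ ⟨hσ₄, σ₂.mem, fun b hb => ?_, ?_⟩
  · rw [h₄.low _ (by omega), h₃.reg]
  · rw [h₄.low _ (by omega), h₃.low _ (by omega)]
    exact hrep₂.reg 0 (by omega)
  · rw [hframe.mem b hb, hmem₁]
  · rw [State.mem_setMem, h₄.mem, h₃.mem]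

end Scope

/-- The memory `μ'` results from `μ` by writing the first `i` of the values `f` into the array
`a`. -/
structure Mem.Filling (μ : Mem) (a : ℕ) (f : ℕ → ℕ) (i : ℕ) (μ' : Mem) : Prop where
  off : ∀ b ≠ a, μ' b = μ b
  done : ∀ j < i, μ' a j = f j
  todo : ∀ j ≥ i, μ' a j = μ a j

theorem Mem.Filling.set {a i : ℕ} {μ μ' : Mem} {f : ℕ → ℕ} (h : μ.Filling a f i μ') :
    μ.Filling a f (i + 1) (μ'.set a i (f i)) := by
  refine ⟨fun b hb => by rw [Mem.set_of_ne _ hb, h.off b hb], fun j hj => ?_, fun j hj => ?_⟩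
  · obtain rfl | hlt := Nat.lt_succ_iff.1 hj |>.eq_or_lt
    · simp
    · simpa [Mem.set_apply, hlt.ne] using h.done j hlt
  · have hne : j ≠ i := by omega
    simpa [Mem.set_apply, hne] using h.todo j (by omega)

theorem Scope.Executes.fill {inp : ℕ → ℕ → ℕ} {L n N a : ℕ} {Γ : Scope inp L} {μ : Mem}
    {lim : Expr} {body : Expr → Cmd} (f : ℕ → ℕ) (hlim : Γ.Evals μ lim n)
    (step : ∀ i < n, ∀ μ', μ.Filling a f i μ' → ∀ Γ' ≥ Γ, ∀ x,
      (∀ μ, Γ'.Evals μ (.var x) i) → Γ'.Executes μ' (body (.var x)) N (· = μ'.set a i (f i))) :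
    Γ.Executes μ (.forTo lim body) (n * (N + 4) + (lim.cost + 2)) (μ.Filling a f n) := by
  refine .forTo (fun i => μ.Filling a f i) hlim
    ⟨fun _ _ => rfl, fun _ h => absurd h (Nat.not_lt_zero _), fun _ _ => rfl⟩
    fun i hi μ' hμ' Γ' hΓ x hx => (step i hi μ' hμ' Γ' hΓ x hx).imp ?_
  rintro _ rfl
  exact hμ'.set

end RAM

namespace WSP

open RAM

/-! ## Sets of steps as numbers -/

open Classical in
/-- The truth value of a proposition as a number. -/
noncomputable def ind (p : Prop) : ℕ := if p then 1 else 0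

section Ind

variable {p q : Prop}

theorem ind_of_true (h : p) : ind p = 1 := if_pos h

theorem ind_of_false (h : ¬ p) : ind p = 0 := if_neg h

theorem ind_ne_zero : ind p ≠ 0 ↔ p := by
  by_cases h : p <;> simp [ind, h]

theorem ind_le_one (p : Prop) : ind p ≤ 1 := by
  by_cases h : p <;> simp [ind, h]

theorem ind_mul (p q : Prop) : ind p * ind q = ind (p ∧ q) := by
  by_cases h : p <;> by_cases h' : q <;> simp [ind, h, h']

theorem one_sub_one_sub (v : ℕ) : 1 - (1 - v) = ind (v ≠ 0) := by
  obtain rfl | h := eq_or_ne v 0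
  · rw [ind_of_false (by simp)]
  · rw [ind_of_true h]; omega

theorem prod_ind {α : Type*} (T : Finset α) (P : α → Prop) :
    ∏ s ∈ T, ind (P s) = ind (∀ s ∈ T, P s) := by
  classical
  simp only [ind]
  rw [Finset.prod_boole]
  congr

end Ind

section Mask

variable {k : ℕ}

theorem testBit_mask {F : Finset (Fin k)} {i : ℕ} :
    (mask F).testBit i = true ↔ ∃ s ∈ F, (s : ℕ) = i := by
  have h := Finset.toFinset_bitIndices_sum_two_pow (F.map Fin.valEmbedding)
  rw [Finset.sum_map] at h
  rw [← Nat.mem_bitIndices, ← List.mem_toFinset]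
  change i ∈ (∑ s ∈ F, 2 ^ (Fin.valEmbedding s)).bitIndices.toFinset ↔ _
  rw [h]
  simp

theorem testBit_mask_fin {F : Finset (Fin k)} {s : Fin k} :
    (mask F).testBit s = true ↔ s ∈ F := by
  rw [testBit_mask]
  exact ⟨fun ⟨s', h, e⟩ => Fin.ext e ▸ h, fun h => ⟨s, h, rfl⟩⟩

theorem mask_div_mod (F : Finset (Fin k)) (s : Fin k) :
    mask F / 2 ^ (s : ℕ) % 2 = ind (s ∈ F) := by
  have h := testBit_mask_fin (F := F) (s := s)
  rw [Nat.testBit_eq_decide_div_mod_eq, decide_eq_true_iff] at h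
  by_cases hs : s ∈ F
  · rw [h.2 hs, ind_of_true hs]
  · rw [ind_of_false hs]
    have := mt h.1 hs
    omega

theorem mask_lt (F : Finset (Fin k)) : mask F < 2 ^ k := by
  have := Nat.geomSum_lt (m := 2) (n := k) (s := F.map Fin.valEmbedding) le_rfl (by simp)
  rwa [Finset.sum_map] at this

theorem mask_injective : Function.Injective (mask (k := k)) := by
  intro F G h
  ext s
  rw [← testBit_mask_fin, h, testBit_mask_fin]

theorem exists_mask_eq {m : ℕ} (h : m < 2 ^ k) : ∃ F : Finset (Fin k), mask F = m := by
  refine ⟨Finset.univ.filter fun s => m.testBit s = true, Nat.eq_of_testBit_eq fun i => ?_⟩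
  rw [Bool.eq_iff_iff, testBit_mask]
  constructor
  · rintro ⟨s, hs, rfl⟩
    exact (Finset.mem_filter.1 hs).2
  · intro hi
    have hk : i < k := (Nat.pow_lt_pow_iff_right (by norm_num)).1
      ((Nat.ge_two_pow_of_testBit hi).trans_lt h)
    exact ⟨⟨i, hk⟩, by simpa using hi, rfl⟩

@[simp] theorem mask_empty : mask (∅ : Finset (Fin k)) = 0 := by simp [mask]

theorem mask_eq_zero {F : Finset (Fin k)} : mask F = 0 ↔ F = ∅ := by
  rw [← mask_empty (k := k)]
  exact mask_injective.eq_iff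

theorem one_sub_mask (F : Finset (Fin k)) : 1 - mask F = ind (F = ∅) := by
  by_cases h : F = ∅
  · rw [ind_of_true h, mask_eq_zero.2 h]
  · rw [ind_of_false h, Nat.sub_eq_zero_of_le (Nat.one_le_iff_ne_zero.2 (mask_eq_zero.not.2 h))]

theorem mask_univ : mask (Finset.univ : Finset (Fin k)) = 2 ^ k - 1 := by
  rw [mask, Fin.sum_univ_eq_sum_range (fun i => 2 ^ i) k, Nat.geomSum_eq le_rfl]
  simp

theorem mask_sdiff {F Y : Finset (Fin k)} (h : Y ⊆ F) : mask (F \ Y) = mask F - mask Y := by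
  have := Finset.sum_sdiff (f := fun s : Fin k => 2 ^ (s : ℕ)) h
  simp only [mask]
  omega

theorem mask_erase {F : Finset (Fin k)} {s : Fin k} (h : s ∈ F) :
    mask (F.erase s) = mask F - 2 ^ (s : ℕ) := by
  rw [Finset.erase_eq, mask_sdiff (by simpa using h)]
  simp [mask]

end Mask

/-- The elements of `Fin k` less than `m`, those that a loop has processed before round `m`. -/
def below (k m : ℕ) : Finset (Fin k) := Finset.univ.filter fun s => (s : ℕ) < m

section Below

variable {k m : ℕ}

@[simp] theorem mem_below {s : Fin k} : s ∈ below k m ↔ (s : ℕ) < m := by simp [below]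

@[simp] theorem below_zero : below k 0 = ∅ := by simp [below]

@[simp] theorem below_self : below k k = Finset.univ := by simp [below]

theorem below_succ (s : Fin k) : below k (s + 1) = insert s (below k s) := by
  ext s'
  simp only [mem_below, Finset.mem_insert, Fin.ext_iff]
  omega

theorem compl_below (s : Fin k) : (below k s)ᶜ = insert s (below k (s + 1))ᶜ := by
  ext s'
  simp only [Finset.mem_compl, mem_below, Finset.mem_insert, Fin.ext_iff]
  omega

end Below

/-! ## The covering product -/

section Zeta

variable {α : Type*} [DecidableEq α] {f g : Finset α → ℕ} {F S : Finset α} {s : α}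

/-- The sum of `f` over the subsets of `F` that differ from `F` only in elements of `S`: the
intermediate values of the fast zeta transform. -/
def partialZeta (S : Finset α) (f : Finset α → ℕ) (F : Finset α) : ℕ :=
  ∑ D ∈ (F ∩ S).powerset, f (F \ D)

@[simp] theorem partialZeta_empty : partialZeta ∅ f = f := by
  ext F
  simp [partialZeta]

theorem partialZeta_insert_of_mem (hF : s ∈ F) (hS : s ∉ S) :
    partialZeta (insert s S) f F = partialZeta S f F + partialZeta S f (F.erase s) := by
  have hs : s ∉ F ∩ S := fun h => hS (Finset.mem_inter.1 h).2
  rw [partialZeta, Finset.inter_insert_of_mem hF, Finset.sum_powerset_insert hs, partialZeta,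
    partialZeta, Finset.erase_inter, Finset.erase_eq_of_notMem hs]
  simp only [Finset.sdiff_insert, Finset.erase_sdiff_comm]

theorem partialZeta_insert_of_notMem (hF : s ∉ F) :
    partialZeta (insert s S) f F = partialZeta S f F := by
  rw [partialZeta, Finset.inter_insert_of_notMem hF, partialZeta]

theorem partialZeta_of_subset (h : F ⊆ S) :
    partialZeta S f F = ∑ Y ∈ F.powerset, f Y := by
  rw [partialZeta, Finset.inter_eq_left.2 h]
  refine Finset.sum_nbij' (F \ ·) (F \ ·) ?_ ?_ ?_ ?_ fun _ _ => rfl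
  all_goals simp +contextual

theorem partialZeta_le {b : ℕ} (hf : ∀ F, f F ≤ b) :
    partialZeta S f F ≤ 2 ^ F.card * b := by
  refine (Finset.sum_le_card_nsmul _ _ _ fun D _ => hf _).trans ?_
  rw [smul_eq_mul, Finset.card_powerset]
  gcongr
  · norm_num
  · exact Finset.inter_subset_left

variable [Fintype α]

/-- The covering product of two set functions. -/
def unionProd (f g : Finset α → ℕ) (V : Finset α) : ℕ :=
  ∑ p : Finset α × Finset α with p.1 ∪ p.2 = V, f p.1 * g p.2

theorem partialZeta_unionProd (f g : Finset α → ℕ) (F : Finset α) :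
    partialZeta Finset.univ (unionProd f g) F =
      partialZeta Finset.univ f F * partialZeta Finset.univ g F := by
  simp only [partialZeta_of_subset (Finset.subset_univ F), unionProd]
  rw [Finset.sum_mul_sum, ← Finset.sum_product', ← Finset.sum_fiberwise_of_maps_to
    (s := F.powerset ×ˢ F.powerset) (t := F.powerset) (g := fun p => p.1 ∪ p.2)]
  · refine Finset.sum_congr rfl fun V hV => Finset.sum_congr ?_ fun _ _ => rfl
    ext p
    simp only [Finset.mem_filter, Finset.mem_univ, true_and, Finset.mem_product,
      Finset.mem_powerset] at hV ⊢
    exact ⟨fun h => ⟨Finset.union_subset_iff.1 (h ▸ hV), h⟩, fun h => h.2⟩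
  · intro p hp
    simp only [Finset.mem_product, Finset.mem_powerset] at hp ⊢
    exact Finset.union_subset hp.1 hp.2

end Zeta

section Weighted

variable {α : Type*} {b : ℕ} {f g : Finset α → Prop}

/-- The indicator of a set family, weighted by a power of `b` that records the cardinality. -/
noncomputable def weighted (b : ℕ) (f : Finset α → Prop) (F : Finset α) : ℕ :=
  ind (f F) * b ^ F.card

theorem weighted_le (hb : 0 < b) [Fintype α] (f : Finset α → Prop) (F : Finset α) :
    weighted b f F ≤ b ^ Fintype.card α :=
  (Nat.mul_le_mul (ind_le_one _) (Nat.pow_le_pow_right hb (Finset.card_le_univ F))).trans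
    (one_mul _).le

variable [DecidableEq α] {X Y V : Finset α}

theorem weighted_mul_weighted (h : Disjoint X Y) :
    weighted b f X * weighted b g Y = ind (f X ∧ g Y) * b ^ (X ∪ Y).card := by
  rw [weighted, weighted, Finset.card_union_of_disjoint h, ← ind_mul, pow_add]
  ring

theorem pow_dvd_weighted_mul_weighted (h : ¬ Disjoint X Y) :
    b ^ ((X ∪ Y).card + 1) ∣ weighted b f X * weighted b g Y := by
  have hpos : 0 < (X ∩ Y).card :=
    Finset.card_pos.2 (Finset.not_disjoint_iff_nonempty_inter.1 h)
  have hcard : (X ∪ Y).card + 1 ≤ X.card + Y.card := by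
    have := Finset.card_union_add_card_inter X Y
    omega
  refine (pow_dvd_pow b hcard).trans ?_
  rw [pow_add]
  exact mul_dvd_mul (Dvd.intro_left _ rfl) (Dvd.intro_left _ rfl)

variable [Fintype α]

open Classical in
theorem sum_disjoint_weighted (V : Finset α) :
    ∑ p : Finset α × Finset α with p.1 ∪ p.2 = V ∧ Disjoint p.1 p.2,
        weighted b f p.1 * weighted b g p.2 =
      {Y ∈ V.powerset | f Y ∧ g (V \ Y)}.card * b ^ V.card := by
  rw [Finset.card_filter, Finset.sum_mul]
  refine Finset.sum_nbij' Prod.fst (fun Y => (Y, V \ Y)) ?_ ?_ ?_ (fun _ _ => rfl) ?_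
  · rintro ⟨X, Y⟩ h
    obtain ⟨rfl, -⟩ : X ∪ Y = V ∧ Disjoint X Y := by simpa using h
    exact Finset.mem_powerset.2 Finset.subset_union_left
  · intro Y hY
    simp [Finset.union_sdiff_of_subset (Finset.mem_powerset.1 hY), Finset.disjoint_sdiff]
  all_goals
    rintro ⟨X, Y⟩ h
    obtain ⟨rfl, hd⟩ : X ∪ Y = V ∧ Disjoint X Y := by simpa using h
    simp [Finset.union_sdiff_cancel_left hd, weighted_mul_weighted hd, ind]

open Classical in
theorem unionProd_weighted_modEq (V : Finset α) :
    unionProd (weighted b f) (weighted b g) V ≡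
      {Y ∈ V.powerset | f Y ∧ g (V \ Y)}.card * b ^ V.card [MOD b ^ (V.card + 1)] := by
  rw [← sum_disjoint_weighted, unionProd,
    ← Finset.sum_filter_add_sum_filter_not _ (fun p => Disjoint p.1 p.2), Finset.filter_filter]
  refine Nat.ModEq.add_left _ (Nat.modEq_zero_iff_dvd.2 (Finset.dvd_sum fun p hp => ?_))
  obtain ⟨rfl, h⟩ : p.1 ∪ p.2 = V ∧ ¬ Disjoint p.1 p.2 := by simpa using hp
  exact pow_dvd_weighted_mul_weighted h

theorem unionProd_weighted_mod_ne_zero (hb : 2 ^ V.card < b) :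
    unionProd (weighted b f) (weighted b g) V % b ^ (V.card + 1) ≠ 0 ↔
      ∃ Y ⊆ V, f Y ∧ g (V \ Y) := by
  classical
  have hpos : 0 < b := pos_of_gt hb
  have hlt : {Y ∈ V.powerset | f Y ∧ g (V \ Y)}.card < b :=
    ((Finset.card_filter_le _ _).trans (Finset.card_powerset V).le).trans_lt hb
  rw [unionProd_weighted_modEq V, Nat.mod_eq_of_lt, Nat.mul_ne_zero_iff, Finset.card_ne_zero]
  · simp [Finset.Nonempty, hpos.ne', Finset.mem_filter]
  · rw [pow_succ, mul_comm]
    exact Nat.mul_lt_mul_of_pos_left hlt (by positivity)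

end Weighted

/-! ## Partial plans -/

theorem Plan.filter_val_eq {k n : ℕ} (π : Plan k n) (s : Fin k) :
    Finset.univ.filter (fun s' => (π s' : ℕ) = π s) = π.block s := by
  ext s'
  simp [Plan.block, Fin.ext_iff]

namespace Workflow

/-- User number `u` exists and may perform the step `s`. -/
def AuthNat (W : Workflow) (s : Fin W.k) (u : ℕ) : Prop := ∃ h : u < W.n, W.auth s ⟨u, h⟩

/-- The set `Y` is empty or eligible for all constraints. -/
def Admissible (W : Workflow) (Y : Finset (Fin W.k)) : Prop :=
  Y = ∅ ∨ ∀ j, (W.con j).Eligible Y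

/-- `Y` may be the set of all steps that user number `u` performs. -/
def Fits (W : Workflow) (u : ℕ) (Y : Finset (Fin W.k)) : Prop :=
  W.Admissible Y ∧ ∀ s ∈ Y, W.AuthNat s u

/-- `C` can be divided among the first `i` users. -/
def Coverable (W : Workflow) : ℕ → Finset (Fin W.k) → Prop
  | 0, C => C = ∅
  | i + 1, C => ∃ Y ⊆ C, W.Coverable i Y ∧ W.Fits i (C \ Y)

/-- The users from number `i` on have been given the steps outside `C`, as recorded by `p`, and
`C` can still be divided among the users before `i`. -/
structure PartialPlan (W : Workflow) (i : ℕ) (C : Finset (Fin W.k)) (p : Fin W.k → ℕ) : Prop where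
  coverable : W.Coverable i C
  le : ∀ s ∉ C, i ≤ p s
  fits : ∀ u ≥ i, W.Fits u {s | s ∉ C ∧ p s = u}

variable {W : Workflow}

theorem fits_empty (u : ℕ) : W.Fits u ∅ := ⟨.inl rfl, by simp⟩

theorem Valid.fits {π : Plan W.k W.n} (h : W.Valid π) (u : ℕ) :
    W.Fits u {s | (π s : ℕ) = u} := by
  obtain he | ⟨s, hs⟩ := (Finset.univ.filter fun s => (π s : ℕ) = u).eq_empty_or_nonempty
  · rw [he]
    exact fits_empty u
  obtain rfl : (π s : ℕ) = u := by simpa using hs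
  rw [π.filter_val_eq]
  refine ⟨.inr fun j hj => hj π ⟨s, rfl⟩ (h.2 j), fun s' hs' => ?_⟩
  rw [← (Finset.mem_filter.1 hs').2]
  exact ⟨(π s').2, h.1 s'⟩

theorem Valid.coverable {π : Plan W.k W.n} (h : W.Valid π) :
    W.Coverable W.n Finset.univ := by
  suffices ∀ i, W.Coverable i {s | (π s : ℕ) < i} by simpa using this W.n
  intro i
  induction i with
  | zero => simp [Coverable]
  | succ i ih =>
    refine ⟨_, Finset.monotone_filter_right _ fun s _ hs => Nat.lt_succ_of_lt hs, ih, ?_⟩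
    convert h.fits i using 1
    ext s
    simp only [Finset.mem_sdiff, Finset.mem_filter, Finset.mem_univ, true_and]
    omega

theorem valid_of_fits (reg : ∀ j, (W.con j).Regular) {π : Plan W.k W.n}
    (h : ∀ u, W.Fits u {s | (π s : ℕ) = u}) : W.Valid π := by
  refine ⟨fun s => ?_, fun j => reg j π fun s => ?_⟩
  · exact ((h (π s)).2 s (by simp)).2
  · have hs : s ∈ π.block s := by simp [Plan.block]
    exact (π.filter_val_eq s ▸ (h (π s)).1).resolve_left (Finset.ne_empty_of_mem hs) j

namespace PartialPlan

variable {i : ℕ} {C Y : Finset (Fin W.k)} {p p' : Fin W.k → ℕ}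

theorem of_coverable (h : W.Coverable i Finset.univ) (p : Fin W.k → ℕ) :
    W.PartialPlan i Finset.univ p :=
  ⟨h, by simp, fun u _ => by simpa using fits_empty u⟩

theorem assign (h : W.PartialPlan (i + 1) C p) (hYC : Y ⊆ C) (hY : W.Coverable i Y)
    (hfits : W.Fits i (C \ Y)) (hp : ∀ s ∈ C \ Y, p' s = i) (hp' : ∀ s ∉ C \ Y, p' s = p s) :
    W.PartialPlan i Y p' := by
  have hle (s) (hs : s ∉ Y) : i ≤ p' s := by
    by_cases hsC : s ∈ C \ Y
    · exact (hp s hsC).ge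
    · rw [hp' s hsC]
      exact Nat.le_of_succ_le (h.le s fun hC => hsC (Finset.mem_sdiff.2 ⟨hC, hs⟩))
  refine ⟨hY, hle, fun u hu => ?_⟩
  obtain rfl | hlt := hu.eq_or_lt
  · convert hfits using 1
    ext s
    by_cases hs : s ∈ C \ Y
    · simpa [hp s hs, hs] using (Finset.mem_sdiff.1 hs).2
    · have := h.le s
      simp only [Finset.mem_sdiff] at hs
      grind
  · convert h.fits u hlt using 1
    ext s
    grind

theorem exists_valid (reg : ∀ j, (W.con j).Regular) (h : W.PartialPlan 0 C p) :
    ∃ π, W.Valid π ∧ ∀ s, p s = (π s : ℕ) := by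
  obtain rfl : C = ∅ := h.coverable
  have hfits (u) : W.Fits u {s | p s = u} := by simpa using h.fits u (Nat.zero_le u)
  have hlt (s) : p s < W.n := ((hfits (p s)).2 s (by simp)).1
  exact ⟨fun s => ⟨p s, hlt s⟩, valid_of_fits reg hfits, fun _ => rfl⟩

end PartialPlan

theorem input_auth (s : Fin W.k) {u : ℕ} (hu : u < W.n) :
    W.input 2 (s * W.n + u) = ind (W.AuthNat s u) := by
  rw [input, ind]
  congr 1
  rw [eq_iff_iff]
  constructor
  · rintro ⟨s', u', e, ha⟩
    have h1 : (s : ℕ) = s' := by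
      have := congrArg (· / W.n) e
      simpa [Nat.add_div_of_dvd_right, hu.pos, Nat.div_eq_of_lt hu,
        Nat.div_eq_of_lt u'.2] using this
    have h2 : u = u' := by rw [h1] at e; omega
    obtain rfl := Fin.ext h1
    subst h2
    exact ⟨hu, ha⟩
  · rintro ⟨_, ha⟩
    exact ⟨s, ⟨u, hu⟩, rfl, ha⟩

end Workflow

/-! ## The memory of the solver -/

/-- The number `2 ^ (k + 1)`, which exceeds the number of pairs of a set of steps and its complement
in it, and whose powers record the cardinalities of sets of steps. -/
def Workflow.base (W : Workflow) : ℕ := 2 ^ (W.k + 1)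

theorem Workflow.base_pos (W : Workflow) : 0 < W.base := by
  simp [base]

theorem Workflow.two_pow_card_lt_base (W : Workflow) (F : Finset (Fin W.k)) :
    2 ^ F.card < W.base :=
  Nat.pow_lt_pow_right one_lt_two (Nat.lt_succ_of_le (by simpa using Finset.card_le_univ F))

/-- Numbers of `L` bits suffice for the solver, if `B` is the cost of an eligibility test. -/
structure Large (W : Workflow) (B L : ℕ) : Prop where
  modulus : 2 ^ B * (2 * W.n + 12 + 2 ^ W.k * W.c) < 2 ^ L
  index : W.k * W.n < 2 ^ L
  square : (2 ^ W.k * W.base ^ W.k) ^ 2 < 2 ^ L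
  weight : W.base ^ (W.k + 1) < 2 ^ L

namespace Large

variable {W : Workflow} {B L m : ℕ}

theorem lt (h : Large W B L) (hm : m ≤ 2 * W.n + 12 + 2 ^ W.k * W.c) : m < 2 ^ L :=
  (hm.trans (Nat.le_mul_of_pos_left _ (by positivity))).trans_lt h.modulus

theorem pow_lt (h : Large W B L) (hm : m ≤ W.k + 1) : 2 ^ m < 2 ^ L :=
  ((Nat.pow_le_pow_right two_pos hm).trans (Nat.le_self_pow (by omega) _)).trans_lt h.weight

theorem steps_lt (h : Large W B L) : W.k + 1 < 2 ^ L :=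
  Nat.lt_two_pow_self.trans (h.pow_lt le_rfl)

theorem base_pow_lt (h : Large W B L) (hm : m ≤ W.k + 1) : W.base ^ m < 2 ^ L :=
  (Nat.pow_le_pow_right W.base_pos hm).trans_lt h.weight

end Large

/-- The array of the plan that is constructed. -/
abbrev plan : ℕ := 0

/-- The array of the powers of two. -/
abbrev power : ℕ := 1

/-- The array of the eligibility of the sets `F` for the constraints `j`, at `F * c + j`. -/
abbrev eligible : ℕ := 2

/-- The array of the admissibility of sets. -/
abbrev admissible : ℕ := 3

/-- The array of the weights `W.base ^ F.card`. -/
abbrev weight : ℕ := 4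

/-- The array of the left factor of a covering product, and of the product. -/
abbrev left : ℕ := 5

/-- The array of the right factor of a covering product. -/
abbrev right : ℕ := 6

/-- The array whose first cell holds the set of the steps that are not yet assigned. -/
abbrev current : ℕ := 7

/-- The array whose first cell holds the steps that stay unassigned after the current user. -/
abbrev choice : ℕ := 8

/-- The array whose first cell holds the result of a test. -/
abbrev test : ℕ := 9

/-- The array that tells which sets the first `u` users cover. -/
abbrev cover (u : ℕ) : ℕ := 2 * u + 10

/-- The array that tells which sets fit the user `u`. -/
abbrev fit (u : ℕ) : ℕ := 2 * u + 11

/-- The expression for the cell `e` of the array `a`. -/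
def cell (a : ℕ) (e : Expr) : Expr := .load (.lit a) e

/-- The number of steps. -/
def steps : Expr := .input 0 0

/-- The number of users. -/
def users : Expr := .input 0 1

/-- The number of constraints. -/
def constraints : Expr := .input 0 2

/-- The number of sets of steps. -/
def numSets : Expr := cell power steps

/-- The expression that evaluates to `W.base`. -/
def base : Expr := cell power (steps + 1)

/-- The expression for bit `s` of `F`. -/
def bit (s F : Expr) : Expr := F / cell power s % 2

section Cost

variable (a : ℕ) (e f : Expr)

@[simp] theorem cost_cell : (cell a e).cost = e.cost + 2 := by
  simp only [cell, Expr.cost_load, Expr.cost_lit]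
  omega

@[simp] theorem cost_steps : steps.cost = 3 := rfl
@[simp] theorem cost_users : users.cost = 3 := rfl
@[simp] theorem cost_constraints : constraints.cost = 3 := rfl
@[simp] theorem cost_numSets : numSets.cost = 5 := rfl
@[simp] theorem cost_bit : (bit e f).cost = e.cost + f.cost + 7 := by
  simp only [bit, Expr.cost_mod, Expr.cost_div, cost_cell, Expr.cost_ofNat]
  omega

end Cost

/-- The array `power` holds the powers of two. -/
def Powers (W : Workflow) (μ : Mem) : Prop := ∀ i ≤ W.k + 1, μ power i = 2 ^ i

section Evals

variable {W : Workflow} {B L i : ℕ} {Γ : Scope W.input L} {μ : Mem} {e f : Expr}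

theorem evals_lit (hL : Large W B L) (hi : i ≤ 12) : Γ.Evals μ (.lit i) i :=
  .lit (hL.lt (by omega))

theorem evals_zero (hL : Large W B L) : Γ.Evals μ 0 0 :=
  evals_lit hL (by decide)

theorem evals_cell (hL : Large W B L) {a : ℕ} (ha : a ≤ 9) (he : Γ.Evals μ e i) :
    Γ.Evals μ (cell a e) (μ a i) :=
  .load (evals_lit hL (by omega)) he

theorem evals_steps (hL : Large W B L) : Γ.Evals μ steps W.k :=
  .input (evals_lit hL (by decide)) (evals_lit hL (by decide))
    ((Nat.le_succ _).trans_lt hL.steps_lt)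

theorem evals_users (hL : Large W B L) : Γ.Evals μ users W.n :=
  .input (evals_lit hL (by decide)) (evals_lit hL (by decide)) (hL.lt (m := W.n) (by omega))

theorem evals_constraints (hL : Large W B L) : Γ.Evals μ constraints W.c :=
  .input (evals_lit hL (by decide)) (evals_lit hL (by decide)) (hL.lt (m := W.c)
    ((Nat.le_mul_of_pos_left _ (by positivity)).trans (Nat.le_add_left _ _)))

theorem evals_power (hL : Large W B L) (hμ : Powers W μ) (he : Γ.Evals μ e i) (hi : i ≤ W.k + 1) :
    Γ.Evals μ (cell power e) (2 ^ i) :=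
  hμ i hi ▸ evals_cell hL (by decide) he

theorem evals_numSets (hL : Large W B L) (hμ : Powers W μ) : Γ.Evals μ numSets (2 ^ W.k) :=
  evals_power hL hμ (evals_steps hL) (Nat.le_succ _)

theorem evals_base (hL : Large W B L) (hμ : Powers W μ) : Γ.Evals μ base W.base :=
  evals_power hL hμ (.add (evals_steps hL) (evals_lit hL (by decide)) hL.steps_lt) le_rfl

theorem evals_bit (hL : Large W B L) (hμ : Powers W μ) {s : Fin W.k} {F : Finset (Fin W.k)}
    (he : Γ.Evals μ e s) (hf : Γ.Evals μ f (mask F)) : Γ.Evals μ (bit e f) (ind (s ∈ F)) :=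
  mask_div_mod F s ▸ .mod (.div hf (evals_power hL hμ he (by omega))) (evals_lit hL (by decide))

end Evals

/-! ## Tables indexed by sets of steps -/

/-- The command `memory[a][i] := init * ∏ s < lim, factor s`, where the product is restricted to the
`s` with `test s ≠ 0`. -/
def prodTo (lim a i init : Expr) (test factor : Expr → Expr) : Cmd :=
  .store a i init ⨟ .forTo lim fun s => .onlyIf (test s) (.store a i (.load a i * factor s))

theorem executes_prodTo {inp : ℕ → ℕ → ℕ} {L n N x y v : ℕ} {Γ : Scope inp L} {μ : Mem}
    {lim a i init : Expr} {test factor : Expr → Expr} (t w : Fin n → ℕ)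
    (hlim : ∀ μ, Γ.Evals μ lim n) (ha : ∀ μ, Γ.Evals μ a x) (hi : ∀ μ, Γ.Evals μ i y)
    (hinit : Γ.Evals μ init v)
    (htest : ∀ (s : Fin n) v', ∀ Γ' ≥ Γ, ∀ z, (∀ μ, Γ'.Evals μ (.var z) s) →
      Γ'.Evals (μ.set x y v') (test (.var z)) (t s))
    (hfactor : ∀ (s : Fin n) v', ∀ Γ' ≥ Γ, ∀ z, (∀ μ, Γ'.Evals μ (.var z) s) →
      Γ'.Evals (μ.set x y v') (factor (.var z)) (w s))
    (hcost : ∀ z, (test (.var z)).cost + (factor (.var z)).cost ≤ N)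
    (hb : ∀ T : Finset (Fin n), v * ∏ s ∈ T, w s < 2 ^ L) :
    Γ.Executes μ (prodTo lim a i init test factor)
      ((n + 1) * (2 * a.cost + 2 * i.cost + N + 9) + (init.cost + lim.cost))
      (· = μ.set x y (v * ∏ s with t s ≠ 0, w s)) := by
  refine (Scope.Executes.seq (.store (ha _) (hi _) hinit ((Scope.Executes.forTo
    (N := 2 * a.cost + 2 * i.cost + N + 5)
    (fun m μ' => μ' = μ.set x y (v * ∏ s ∈ below n m with t s ≠ 0, w s))
    (hlim _) (by simp) ?_).imp fun μ' h => by simpa using h))).mono (by linarith)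
  rintro m hm _ rfl Γ' hΓ z hz
  lift m to Fin n using hm
  have hz' := htest m (v * ∏ s ∈ below n m with t s ≠ 0, w s) Γ' hΓ z hz
  rw [below_succ, Finset.filter_insert]
  refine (Scope.Executes.onlyIf hz' (fun ht => ?_) fun ht => by simp [ht]).mono
    (N := (test (.var z)).cost + (2 * a.cost + 2 * i.cost + (factor (.var z)).cost + 3) + 2)
    (by have := hcost z; omega)
  rw [if_pos ht, Finset.prod_insert (by simp)]
  refine (Scope.Executes.store ((ha _).mono hΓ) ((hi _).mono hΓ) (.mul (.load ((ha _).mono hΓ)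
    ((hi _).mono hΓ)) (hfactor m _ Γ' hΓ z hz) ?_) ?_).mono
    (by simp only [Expr.cost_mul, Expr.cost_load]; omega)
  · convert hb (insert m {s ∈ below n m | t s ≠ 0}) using 1
    rw [Finset.prod_insert (by simp)]
    simp only [Mem.set_self]; ring
  · simp only [Mem.set_self, Mem.set_set]; ring_nf

/-- The memory `μ'` results from `μ` by writing the table `f` of all sets into the array `a`. -/
structure Tabulated {k : ℕ} (μ : Mem) (a : ℕ) (f : Finset (Fin k) → ℕ) (μ' : Mem) : Prop where
  off : ∀ b ≠ a, μ' b = μ b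
  eq : ∀ F, μ' a (mask F) = f F

/-- The loop over the codes of all sets of steps. -/
def forSets (body : Expr → Cmd) : Cmd := .forTo numSets body

section Tables

variable {W : Workflow} {B L N N' a : ℕ} {Γ : Scope W.input L} {μ : Mem}

theorem executes_forSets {body : Expr → Cmd} (f : Finset (Fin W.k) → ℕ) (hL : Large W B L)
    (hμ : Powers W μ)
    (step : ∀ F μ', μ.Filling a (Function.extend mask f 0) (mask F) μ' → ∀ Γ' ≥ Γ, ∀ x,
      (∀ μ, Γ'.Evals μ (.var x) (mask F)) →
        Γ'.Executes μ' (body (.var x)) N (· = μ'.set a (mask F) (f F))) :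
    Γ.Executes μ (forSets body) (2 ^ W.k * (N + 11)) (Tabulated μ a f) := by
  refine (Scope.Executes.fill (N := N) (Function.extend mask f 0) (evals_numSets hL hμ)
    fun i hi μ' hμ' Γ' hΓ x hx => ?_).mono ?_ |>.imp fun μ' h => ⟨h.off, fun F => ?_⟩
  · obtain ⟨F, rfl⟩ := exists_mask_eq hi
    rw [mask_injective.extend_apply]
    exact step F μ' hμ' Γ' hΓ x hx
  · have := Nat.one_le_two_pow (n := W.k)
    simp only [cost_numSets]
    linarith
  · rw [h.done _ (mask_lt F), mask_injective.extend_apply]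

/-- The command that writes the table of the values of `e` into the array `a`. -/
def tabulate (a : Expr) (e : Expr → Expr) : Cmd := forSets fun F => .store a F (e F)

theorem executes_tabulate {ea : Expr} {e : Expr → Expr} (f : Finset (Fin W.k) → ℕ)
    (hL : Large W B L) (hμ : Powers W μ) (ha : ∀ μ, Γ.Evals μ ea a)
    (he : ∀ F μ', (∀ b ≠ a, μ' b = μ b) → μ' a (mask F) = μ a (mask F) → ∀ Γ' ≥ Γ, ∀ x,
      (∀ μ, Γ'.Evals μ (.var x) (mask F)) → Γ'.Evals μ' (e (.var x)) (f F))
    (hcost : ∀ x, ea.cost + (e (.var x)).cost ≤ N) :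
    Γ.Executes μ (tabulate ea e) (2 ^ W.k * (N + 14)) (Tabulated μ a f) := by
  refine executes_forSets (N := N + 3) f hL hμ fun F μ' hμ' Γ' hΓ x hx => ?_
  refine (Scope.Executes.store (Q := (· = μ'.set a (mask F) (f F)))
    ((ha _).mono hΓ) (hx _) (he F μ' hμ'.off (hμ'.todo _ le_rfl) Γ' hΓ x hx) rfl).mono ?_
  have := hcost x
  simp only [Expr.cost_var]
  omega

/-- The command that writes the table of `init F * ∏ s ∈ F, factor F s` into the array `a`. -/
def tabulateProd (a : Expr) (init : Expr → Expr) (factor : Expr → Expr) : Cmd :=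
  forSets fun F => prodTo steps a F (init F) (fun s => bit s F) factor

theorem executes_tabulateProd {ea : Expr} {init factor : Expr → Expr}
    (v : Finset (Fin W.k) → ℕ) (w : Fin W.k → ℕ) (hL : Large W B L) (hμ : Powers W μ)
    (hap : a ≠ power) (ha : ∀ μ, Γ.Evals μ ea a)
    (hinit : ∀ F μ', (∀ b ≠ a, μ' b = μ b) → ∀ Γ' ≥ Γ, ∀ x,
      (∀ μ, Γ'.Evals μ (.var x) (mask F)) → Γ'.Evals μ' (init (.var x)) (v F))
    (hfactor : ∀ (s : Fin W.k) μ', (∀ b ≠ a, μ' b = μ b) → ∀ Γ' ≥ Γ, ∀ z,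
      (∀ μ, Γ'.Evals μ (.var z) s) → Γ'.Evals μ' (factor (.var z)) (w s))
    (hcost : ∀ x, 2 * ea.cost + (init (.var x)).cost ≤ N)
    (hcost' : ∀ z, (factor (.var z)).cost ≤ N')
    (hb : ∀ F T, v F * ∏ s ∈ T, w s < 2 ^ L) :
    Γ.Executes μ (tabulateProd ea init factor) (2 ^ W.k * ((W.k + 1) * (N + N' + 38)))
      (Tabulated μ a fun F => v F * ∏ s ∈ F, w s) := by
  refine (executes_forSets (N := (W.k + 1) * (N + N' + 27)) _ hL hμ
    fun F μ' hμ' Γ' hΓ x hx => ?_).mono (Nat.mul_le_mul_left _ (by linarith))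
  have hoff {v'} (b) (hb : b ≠ a) : μ'.set a (mask F) v' b = μ b := by
    rw [Mem.set_of_ne _ hb, hμ'.off b hb]
  have hp {v'} : Powers W (μ'.set a (mask F) v') := by rwa [Powers, hoff _ hap.symm]
  convert (executes_prodTo (N := N' + 11) (test := fun s => bit s (.var x))
    (fun s => ind (s ∈ F)) w (fun _ => evals_steps hL)
    (fun _ => (ha _).mono hΓ) hx (hinit F μ' hμ'.off Γ' hΓ x hx)
    (fun s v' Γ'' hΓ' z hz => evals_bit hL hp (hz _) ((hx _).mono hΓ'))
    (fun s v' Γ'' hΓ' z hz => hfactor s _ hoff Γ'' (hΓ.trans hΓ') z hz)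
    (fun z => ?_) (hb F)).mono ?_ using 3
  · simp [ind_ne_zero]
  · have := hcost' z
    simp only [cost_bit, Expr.cost_var]
    omega
  · have := hcost x
    simp only [cost_steps, Expr.cost_var]
    nlinarith

end Tables

/-- The command that combines the entry of the array `a` for every set `F` with `s ∈ F` with the
entry for `F.erase s`. -/
def sweep (a : ℕ) (comb : Expr → Expr → Expr) (s : Expr) : Cmd :=
  forSets fun F => .onlyIf (bit s F)
    (.store (.lit a) F (comb (cell a F) (cell a (F - cell power s))))

/-- The command that performs the sweeps over the array `a` for all steps. -/
def transform (a : ℕ) (comb : Expr → Expr → Expr) : Cmd := .forTo steps (sweep a comb)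

/-- The command that replaces the table in `left` by its covering product with the table in
`right`. -/
def coveringProduct : Cmd :=
  transform left (· + ·) ⨟ transform right (· + ·) ⨟
    tabulate (.lit left) (fun F => cell left F * cell right F) ⨟ transform left (· - ·)

section Convolution

variable {W : Workflow} {B L a : ℕ} {Γ : Scope W.input L} {μ : Mem} {comb : Expr → Expr → Expr}

theorem executes_sweep {s : Fin W.k} {x : ℕ} (f g : Finset (Fin W.k) → ℕ) (hL : Large W B L)
    (hμ : Powers W μ) (ha : a ≤ 9) (hap : a ≠ power) (hs : ∀ μ, Γ.Evals μ (.var x) s)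
    (hf : ∀ F, μ a (mask F) = f F) (hnot : ∀ F, s ∉ F → g F = f F)
    (hmem : ∀ F, s ∈ F → ∀ (Γ : Scope W.input L) μ e e', Γ.Evals μ e (f F) →
      Γ.Evals μ e' (f (F.erase s)) → Γ.Evals μ (comb e e') (g F))
    (hcost : ∀ e e', (comb e e').cost = e.cost + e'.cost + 1) :
    Γ.Executes μ (sweep a comb (.var x)) (2 ^ W.k * 42) (Tabulated μ a g) := by
  refine executes_forSets (N := 31) g hL hμ fun F μ' hμ' Γ' hΓ y hy => ?_
  have hp : Powers W μ' := by rwa [Powers, hμ'.off _ hap.symm]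
  have hF : μ' a (mask F) = f F := (hμ'.todo _ le_rfl).trans (hf F)
  have hbit := evals_bit hL hp ((hs _).mono hΓ) (hy _)
  refine (Scope.Executes.onlyIf hbit (fun h => ?_) fun h => ?_).mono (N := 11 + 18 + 2) le_rfl
  · rw [ind_ne_zero] at h
    have herase : μ' a (mask F - 2 ^ (s : ℕ)) = f (F.erase s) := by
      have hlt : mask (F.erase s) < mask F := by
        rw [mask_erase h]
        exact Nat.sub_lt (Nat.pos_of_ne_zero fun h₀ => by simp [mask_eq_zero.1 h₀] at h)
          (by positivity)
      rw [← mask_erase h, hμ'.done _ hlt, mask_injective.extend_apply, hnot _ (by simp)]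
    refine (Scope.Executes.store (Q := (· = μ'.set a (mask F) (g F))) (evals_lit hL (by omega))
      (hy _) (hmem F h Γ' μ' _ _ (hF ▸ evals_cell hL ha (hy _)) (herase ▸ evals_cell hL ha
        (.sub (hy _) (evals_power hL hp ((hs _).mono hΓ) (by omega))))) rfl).mono ?_
    simp only [hcost, cost_cell, Expr.cost_lit, Expr.cost_sub, Expr.cost_var]
    rfl
  · rw [← not_ne_iff, ind_ne_zero] at h
    simp [hnot F h, ← hF, Mem.set]

theorem executes_transform (X : ℕ → Finset (Fin W.k) → ℕ) (hL : Large W B L)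
    (hμ : Powers W μ) (ha : a ≤ 9) (hap : a ≠ power) (hX : ∀ F, μ a (mask F) = X 0 F)
    (hnot : ∀ (s : Fin W.k) F, s ∉ F → X (s + 1) F = X s F)
    (hmem : ∀ (s : Fin W.k) F, s ∈ F → ∀ (Γ : Scope W.input L) μ e e', Γ.Evals μ e (X s F) →
      Γ.Evals μ e' (X s (F.erase s)) → Γ.Evals μ (comb e e') (X (s + 1) F))
    (hcost : ∀ e e', (comb e e').cost = e.cost + e'.cost + 1) :
    Γ.Executes μ (transform a comb) (2 ^ W.k * ((W.k + 1) * 46)) (Tabulated μ a (X W.k)) := by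
  refine (Scope.Executes.forTo (N := 2 ^ W.k * 42) (fun m => Tabulated μ a (X m))
    (evals_steps hL) ⟨fun _ _ => rfl, hX⟩ fun i hi μ' hμ' Γ' _ x hx => ?_).mono ?_
  · lift i to Fin W.k using hi
    have hp : Powers W μ' := by rwa [Powers, hμ'.off _ hap.symm]
    refine (executes_sweep (X i) (X (i + 1)) hL hp ha hap hx hμ'.eq (hnot i) (hmem i) hcost).imp
      fun μ'' h => ⟨fun b hb => (h.off b hb).trans (hμ'.off b hb), h.eq⟩
  · have := Nat.one_le_two_pow (n := W.k)
    simp only [cost_steps]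
    nlinarith

theorem executes_zeta {f : Finset (Fin W.k) → ℕ} (hL : Large W B L) (hμ : Powers W μ)
    (ha : a ≤ 9) (hap : a ≠ power) (hf : ∀ F, μ a (mask F) = f F)
    (hb : ∀ S F, partialZeta S f F < 2 ^ L) :
    Γ.Executes μ (transform a (· + ·)) (2 ^ W.k * ((W.k + 1) * 46))
      (Tabulated μ a (partialZeta Finset.univ f)) := by
  rw [← below_self]
  refine executes_transform (fun m => partialZeta (below W.k m) f) hL hμ ha hap (by simpa using hf)
    (fun s F h => ?_) (fun s F h Γ μ e e' he he' => ?_) fun e e' => rfl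
  · rw [below_succ, partialZeta_insert_of_notMem h]
  · have hs : s ∉ below W.k s := by simp
    have hlt := hb (below W.k (s + 1)) F
    rw [below_succ, partialZeta_insert_of_mem h hs] at hlt ⊢
    exact .add he he' hlt

theorem executes_moebius {f : Finset (Fin W.k) → ℕ} (hL : Large W B L) (hμ : Powers W μ)
    (ha : a ≤ 9) (hap : a ≠ power) (hf : ∀ F, μ a (mask F) = partialZeta Finset.univ f F) :
    Γ.Executes μ (transform a (· - ·)) (2 ^ W.k * ((W.k + 1) * 46)) (Tabulated μ a f) := by
  have hk : partialZeta (below W.k W.k)ᶜ f = f := by simp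
  rw [← hk]
  refine executes_transform (fun m => partialZeta (below W.k m)ᶜ f) hL hμ ha hap
    (by simpa using hf) (fun s F h => ?_) (fun s F h Γ μ e e' he he' => ?_) fun e e' => rfl
  · rw [compl_below s, partialZeta_insert_of_notMem h]
  · have hs : s ∉ (below W.k (s + 1))ᶜ := by simp
    rw [compl_below s] at he he'
    rw [partialZeta_insert_of_mem h hs] at he
    rw [partialZeta_insert_of_notMem (Finset.notMem_erase s F)] at he'
    simpa using he.sub he'

theorem executes_coveringProduct {f g : Finset (Fin W.k) → ℕ} (hL : Large W B L)
    (hμ : Powers W μ) (hfl : ∀ F, μ left (mask F) = f F) (hgr : ∀ F, μ right (mask F) = g F)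
    (hf : ∀ F, f F ≤ W.base ^ W.k) (hg : ∀ F, g F ≤ W.base ^ W.k) :
    Γ.Executes μ coveringProduct (2 ^ W.k * ((W.k + 1) * 162)) fun μ' =>
      (∀ b, b ≠ left → b ≠ right → μ' b = μ b) ∧ ∀ F, μ' left (mask F) = unionProd f g F := by
  have hzeta {h : Finset (Fin W.k) → ℕ} (hh : ∀ F, h F ≤ W.base ^ W.k) (S F) :
      partialZeta S h F ≤ 2 ^ W.k * W.base ^ W.k :=
    (partialZeta_le hh).trans (Nat.mul_le_mul_right _ (Nat.pow_le_pow_right two_pos (by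
      simpa using Finset.card_le_univ F)))
  have hlt : 2 ^ W.k * W.base ^ W.k < 2 ^ L := (Nat.le_self_pow two_ne_zero _).trans_lt hL.square
  refine Scope.Executes.mono (.seq <| (executes_zeta hL hμ (by decide) (by decide) hfl
    fun S F => (hzeta hf S F).trans_lt hlt).imp fun μ₁ h₁ => ?_)
    (N := 2 ^ W.k * ((W.k + 1) * 46) + (2 ^ W.k * ((W.k + 1) * 46) +
      (2 ^ W.k * 24 + 2 ^ W.k * ((W.k + 1) * 46)))) (by
    simp only [← Nat.mul_add]
    exact Nat.mul_le_mul_left _ (by omega))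
  have hp₁ : Powers W μ₁ := by rwa [Powers, h₁.off _ (by decide)]
  refine .seq <| (executes_zeta hL hp₁ (by decide) (by decide)
    (fun F => h₁.off right (by decide) ▸ hgr F)
    fun S F => (hzeta hg S F).trans_lt hlt).imp fun μ₂ h₂ => ?_
  have hp₂ : Powers W μ₂ := by rwa [Powers, h₂.off _ (by decide)]
  have hl₂ (F) : μ₂ left (mask F) = partialZeta Finset.univ f F := by
    rw [h₂.off _ (by decide), h₁.eq]
  refine .seq <| (executes_tabulate (N := 10)
    (partialZeta Finset.univ (unionProd f g)) hL hp₂ (fun _ => evals_lit hL (by decide))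
    (fun F μ' hμ' hF Γ' _ x hx => ?_) fun x => le_rfl).imp fun μ₃ h₃ => ?_
  · rw [partialZeta_unionProd, ← h₂.eq, ← hl₂, ← hF, ← hμ' right (by decide)]
    refine .mul (evals_cell hL (by decide) (hx _)) (evals_cell hL (by decide) (hx _)) ?_
    rw [hF, hl₂, hμ' right (by decide), h₂.eq]
    exact (Nat.mul_le_mul (hzeta hf _ F) (hzeta hg _ F)).trans_lt (sq (2 ^ W.k * _) ▸ hL.square)
  have hp₃ : Powers W μ₃ := by rwa [Powers, h₃.off _ (by decide)]
  refine (executes_moebius hL hp₃ (by decide) (by decide) h₃.eq).imp fun μ₄ h₄ =>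
    ⟨fun b hl hr => ?_, h₄.eq⟩
  rw [h₄.off b hl, h₃.off b hl, h₂.off b hr, h₁.off b hl]

end Convolution

/-! ## Tables of eligible and coverable sets -/

/-- The command that fills the array `power`. -/
def powers : Cmd :=
  .store (.lit power) 0 1 ⨟
  .forTo (steps + 1) fun i => .store (.lit power) (i + 1) (2 * cell power i)

/-- The number of arrays that the solver uses. -/
def numArrays : Expr := 2 * users + 12

/-- The command that fills the array `eligible`. The arrays of the solver and of the calls of the
eligibility test `E` are kept apart by their residues modulo `numArrays + numSets * constraints`. -/
def eligibility (E : Prog) : Cmd :=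
  .forTo (numSets * constraints) fun q =>
    .call E (numArrays + numSets * constraints) (numArrays + q) (q % constraints) (q / constraints)
      (.lit eligible) q

/-- The command that fills the array `admissible`. -/
def admissibility : Cmd :=
  forSets fun F => prodTo constraints (.lit admissible) F 1 (fun _ => F) fun j =>
    cell eligible (F * constraints + j)

section Tests

variable {W : Workflow} {B L : ℕ} {Γ : Scope W.input L} {μ : Mem}

theorem executes_powers (hL : Large W B L) (μ : Mem) :
    Γ.Executes μ powers ((W.k + 1) * 27) fun μ' =>
      (∀ b ≠ power, μ' b = μ b) ∧ Powers W μ' := by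
  have hlit {Γ : Scope W.input L} {μ i} (hi : i ≤ 12) : Γ.Evals μ (.lit i) i := evals_lit hL hi
  refine .mono (.seq <| .store (hlit (by decide)) (hlit (by decide)) (hlit (by decide)) <|
    (Scope.Executes.forTo (N := 12) (n := W.k + 1)
      (fun i μ' => (∀ b ≠ power, μ' b = μ b) ∧ ∀ j ≤ i, μ' power j = 2 ^ j)
      (.add (evals_steps hL) (hlit (by decide)) hL.steps_lt) ?_
      fun i hi μ' hμ' Γ' _ x hx => ?_).imp fun μ' h => ⟨h.1, h.2⟩) (by
        simp only [Expr.cost_lit, Expr.cost_ofNat, Expr.cost_add, cost_steps]; omega)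
  · exact ⟨fun b hb => Mem.set_of_ne _ hb _ _, fun j hj => by simp [Nat.le_zero.1 hj]⟩
  · have hpow : 2 * μ' power i = 2 ^ (i + 1) := by rw [hμ'.2 i le_rfl, pow_succ']
    have hval : Γ'.Evals μ' (2 * cell power (.var x)) (2 ^ (i + 1)) :=
      hpow ▸ Scope.Evals.mul (hlit (by decide)) (evals_cell hL (by decide) (hx _))
        (hpow ▸ hL.pow_lt (by omega))
    refine .mono (.store (hlit (by decide)) (.add (hx _) (hlit (by decide)) ?_) hval
      ⟨fun b hb => ?_, fun j hj => ?_⟩) le_rfl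
    · exact hL.steps_lt.trans_le' (by omega)
    · rw [Mem.set_of_ne _ hb, hμ'.1 b hb]
    · rw [Mem.set_apply]
      split_ifs with h
      · rw [h.2]
      · exact hμ'.2 j (by omega)

theorem evals_numArrays (hL : Large W B L) : Γ.Evals μ numArrays (2 * W.n + 12) :=
  .add (.mul (evals_lit hL (by decide)) (evals_users hL) (hL.lt (by omega)))
    (evals_lit hL (by decide)) (hL.lt (by omega))

/-- The first `m` eligibility tests have been performed, starting from the memory `μ`, without using
the arrays that belong to the later ones. -/
structure Tested (W : Workflow) (μ : Mem) (m : ℕ) (μ' : Mem) : Prop where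
  keep : ∀ a < 2 * W.n + 12, a ≠ eligible → μ' a = μ a
  fresh : ∀ a, 2 * W.n + 12 + m ≤ a % (2 * W.n + 12 + 2 ^ W.k * W.c) → μ' a = 0
  table : ∀ (F : Finset (Fin W.k)) (j : Fin W.c), mask F * W.c + j < m →
    μ' eligible (mask F * W.c + j) = ind ((W.con j).Eligible F)

theorem Tested.succ {m : ℕ} {F : Finset (Fin W.k)} {j : Fin W.c} {μ₁ μ₂ : Mem}
    (h : Tested W μ m μ₁) (hm : m < 2 ^ W.k * W.c) (hF : mask F = m / W.c) (hj : (j : ℕ) = m % W.c)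
    (hμ₂ : ∀ b, b % (2 * W.n + 12 + 2 ^ W.k * W.c) ≠ 2 * W.n + 12 + m → μ₂ b = μ₁ b) :
    Tested W μ (m + 1) (μ₂.set eligible m (ind ((W.con j).Eligible F))) := by
  have hkeep (a) (ha : a < 2 * W.n + 12) : μ₂ a = μ₁ a := hμ₂ a (by rw [Nat.mod_eq_of_lt] <;> omega)
  refine ⟨fun a ha he => ?_, fun a ha => ?_, fun F' j' h' => ?_⟩
  · rw [Mem.set_of_ne _ he, hkeep a ha, h.keep a ha he]
  · have he : a ≠ eligible := by
      rintro rfl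
      rw [Nat.mod_eq_of_lt (by change 2 < _; omega)] at ha
      exact absurd ha (by change ¬ _ ≤ 2; omega)
    rw [Mem.set_of_ne _ he, hμ₂ a (by omega), h.fresh a (by omega)]
  · rw [Mem.set_apply]
    split_ifs with heq
    · obtain rfl : j' = j := Fin.ext (by
        rw [hj, ← heq.2, Nat.mul_add_mod_self_right, Nat.mod_eq_of_lt j'.2])
      obtain rfl : F' = F := mask_injective (by
        rw [hF, ← heq.2, mul_comm, Nat.mul_add_div j'.pos, Nat.div_eq_of_lt j'.2, add_zero])
      rfl
    · rw [hkeep _ (Nat.lt_add_left _ (by decide)), h.table F' j' (by omega)]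

theorem executes_eligibility {E : Prog} (hE : DecidesEligibility E W B) (hL : Large W B L)
    (hμ : Powers W μ) (h₀ : ∀ a ≥ 2 * W.n + 12, μ a = 0) :
    Γ.Executes μ (eligibility E) (2 ^ W.k * W.c * (E.regBound + 3 * B + 50) + 11)
      (Tested W μ (2 ^ W.k * W.c)) := by
  have hlim {Γ : Scope W.input L} {μ} (hp : Powers W μ) :
      Γ.Evals μ (numSets * constraints) (2 ^ W.k * W.c) :=
    .mul (evals_numSets hL hp) (evals_constraints hL) (hL.lt (by omega))
  refine .mono (.forTo (N := E.regBound + 3 * B + 46) (Tested W μ) (hlim hμ) ⟨fun _ _ _ => rfl,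
    fun a ha => h₀ a (by have := Nat.mod_le a (2 * W.n + 12 + 2 ^ W.k * W.c); omega), by simp⟩
    fun q hq μ' hμ' Γ' _ x hx => ?_) le_rfl
  have hc : 0 < W.c := Nat.pos_of_ne_zero fun h => by simp [h] at hq
  have hp : Powers W μ' := by rwa [Powers, hμ'.keep _ (Nat.lt_add_left _ (by decide)) (by decide)]
  obtain ⟨F, hF⟩ := exists_mask_eq ((Nat.div_lt_iff_lt_mul hc).2 hq)
  obtain ⟨t, σ, hrun, ht, hσ⟩ := hE ⟨q % W.c, Nat.mod_lt _ hc⟩ F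
  rw [hF] at hrun
  refine ((Scope.Executes.call hrun ht (Nat.add_lt_add_left hq _) hL.modulus.le
    (.add (evals_numArrays hL) (hlim hp) (hL.lt le_rfl))
    (.add (evals_numArrays hL) (hx _) (hL.lt (by omega)))
    (.mod (hx _) (evals_constraints hL)) (.div (hx _) (evals_constraints hL))
    (fun _ => evals_lit hL (by decide)) hx fun b hb => hμ'.fresh b hb.ge).imp ?_).mono ?_
  · rintro _ ⟨μ₂, hμ₂, rfl⟩
    rw [hσ]
    exact hμ'.succ hq hF rfl hμ₂
  · simp only [numArrays, Expr.cost_add, Expr.cost_mul, Expr.cost_ofNat, cost_users, cost_numSets,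
      cost_constraints, Expr.cost_var, Expr.cost_mod, Expr.cost_div, Expr.cost_lit]
    omega

theorem mask_mul_add_lt (F : Finset (Fin W.k)) (j : Fin W.c) :
    mask F * W.c + j < 2 ^ W.k * W.c := by
  have h := Nat.mul_le_mul_right W.c (Nat.succ_le_of_lt (mask_lt F))
  have := j.2
  rw [Nat.succ_mul] at h
  omega

theorem executes_admissibility (hL : Large W B L) (hμ : Powers W μ)
    (h : ∀ (F : Finset (Fin W.k)) (j : Fin W.c),
      μ eligible (mask F * W.c + j) = ind ((W.con j).Eligible F)) :
    Γ.Executes μ admissibility (2 ^ W.k * ((W.c + 1) * 43))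
      (Tabulated μ admissible fun F => ind (W.Admissible F)) := by
  refine (executes_forSets (N := (W.c + 1) * 28 + 4) _ hL hμ fun F μ' hμ' Γ' _ x hx => ?_).mono
    (Nat.mul_le_mul_left _ (by omega))
  have hval : 1 * ∏ j : Fin W.c with mask F ≠ 0, ind ((W.con j).Eligible F) =
      ind (W.Admissible F) := by
    rw [one_mul, prod_ind]
    congr 1
    simp only [Workflow.Admissible, mask_eq_zero, or_iff_not_imp_left, ne_eq, eq_iff_iff]
    grind
  rw [← hval]
  refine executes_prodTo (N := 13) (fun _ => mask F) (fun j => ind ((W.con j).Eligible F))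
    (fun _ => evals_constraints hL) (fun _ => evals_lit hL (by decide)) hx
    (evals_lit hL (by decide)) (fun j v Γ'' hΓ' z _ => (hx _).mono hΓ')
    (fun j v Γ'' hΓ' z hz => ?_) (fun z => le_rfl) fun T => ?_
  · have hidx := mask_mul_add_lt F j
    rw [← h, ← hμ'.off eligible (by decide), ← Mem.set_of_ne μ' (by decide : eligible ≠ admissible)]
    exact evals_cell hL (by decide) (.add (.mul ((hx _).mono hΓ') (evals_constraints hL)
      (hL.lt (by omega))) (hz _) (hL.lt (by omega)))
  · rw [one_mul, prod_ind]
    exact (ind_le_one _).trans_lt ((Nat.le_add_left 1 _).trans_lt hL.steps_lt)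

end Tests

/-- The number of the array `cover u`. -/
def coverArray (u : Expr) : Expr := 2 * u + 10

/-- The number of the array `fit u`. -/
def fitArray (u : Expr) : Expr := 2 * u + 11

/-- The command that fills the array `a` with the weights of the sets that the array `b` marks, and
with zeros for the other sets. -/
def weigh (a : ℕ) (b : Expr) : Cmd :=
  tabulate (.lit a) fun F => .load b F * cell weight F

/-- The command that fills the array `fit u`. -/
def fits (u : Expr) : Cmd :=
  tabulateProd (fitArray u) (cell admissible) fun s => .input 2 (s * users + u)

/-- The command that writes the covering product of the weights in the arrays `cover u` and `fit u`
into the array `left`. -/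
def combine (u : Expr) : Cmd :=
  weigh left (coverArray u) ⨟ weigh right (fitArray u) ⨟ coveringProduct

/-- The command that fills the arrays `fit u` and `cover (u + 1)`, given the array `cover u`. -/
def extendCover (u : Expr) : Cmd :=
  fits u ⨟ combine u ⨟
    tabulate (coverArray (u + 1)) fun F => 1 - (1 - cell left F % (cell weight F * base))

/-- The arrays that do not hold a table for later use. -/
abbrev scratch : List ℕ := [plan, left, right, current, choice, test]

/-- The tables for the first `m` users are in the memory. -/
structure CoverTables (W : Workflow) (m : ℕ) (μ : Mem) : Prop where
  powers : Powers W μ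
  admissible_eq : ∀ F, μ admissible (mask F) = ind (W.Admissible F)
  weight_eq : ∀ F : Finset (Fin W.k), μ weight (mask F) = W.base ^ F.card
  fit_eq : ∀ u < m, ∀ F, μ (fit u) (mask F) = ind (W.Fits u F)
  cover_eq : ∀ u ≤ m, ∀ F, μ (cover u) (mask F) = ind (W.Coverable u F)

section Layers

variable {W : Workflow} {B L u x : ℕ} {Γ : Scope W.input L} {μ : Mem} {e : Expr}

theorem ne_fit {a : ℕ} (ha : a ≤ 9) (u : ℕ) : a ≠ fit u := by
  dsimp only [fit]
  omega

theorem ne_cover {a : ℕ} (ha : a ≤ 9) (u : ℕ) : a ≠ cover u := by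
  dsimp only [cover]
  omega

theorem CoverTables.congr {m : ℕ} {μ' : Mem} (h : CoverTables W m μ)
    (hμ : ∀ b ∉ scratch, b ≤ cover m → μ' b = μ b) : CoverTables W m μ' := by
  have hle {a : ℕ} (ha : a ≤ 9) : a ≤ cover m := by dsimp only [cover]; omega
  have hscratch {b : ℕ} (hb : ∀ {a}, a ≤ 9 → a ≠ b) : b ∉ scratch := fun h =>
    hb ((by decide : ∀ a ∈ scratch, a ≤ 9) b h) rfl
  refine ⟨?_, fun F => ?_, fun F => ?_, fun u hu F => ?_, fun u hu F => ?_⟩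
  · rw [Powers, hμ _ (by decide) (hle (by decide))]
    exact h.powers
  · rw [hμ _ (by decide) (hle (by decide)), h.admissible_eq]
  · rw [hμ _ (by decide) (hle (by decide)), h.weight_eq]
  · rw [hμ _ (hscratch (ne_fit · u)) (by dsimp only [fit, cover]; omega), h.fit_eq u hu]
  · rw [hμ _ (hscratch (ne_cover · u)) (by dsimp only [cover]; omega), h.cover_eq u hu]

theorem evals_coverArray (hL : Large W B L) (he : Γ.Evals μ e u) (hu : u ≤ W.n) :
    Γ.Evals μ (coverArray e) (cover u) :=
  .add (.mul (evals_lit hL (by decide)) he (hL.lt (by omega))) (evals_lit hL (by decide))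
    (hL.lt (by omega))

theorem evals_fitArray (hL : Large W B L) (he : Γ.Evals μ e u) (hu : u < W.n) :
    Γ.Evals μ (fitArray e) (fit u) :=
  .add (.mul (evals_lit hL (by decide)) he (hL.lt (by omega))) (evals_lit hL (by decide))
    (hL.lt (by omega))

theorem executes_weigh {a b : ℕ} {f : Finset (Fin W.k) → Prop} (hL : Large W B L)
    (hμ : CoverTables W u μ) (ha : a ≤ 9) (haw : weight ≠ a) (hab : b ≠ a)
    (he : ∀ μ, Γ.Evals μ e b) (hcost : e.cost = 6) (hf : ∀ F, μ b (mask F) = ind (f F)) :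
    Γ.Executes μ (weigh a e) (2 ^ W.k * 29) (Tabulated μ a (weighted W.base f)) := by
  refine executes_tabulate (N := 15) _ hL hμ.powers (fun _ => evals_lit hL (by omega))
    (fun F μ' hoff _ Γ' hΓ x hx => ?_) fun x => by simp [hcost]
  rw [weighted, ← hf, ← hμ.weight_eq, ← hoff b hab, ← hoff _ haw]
  refine .mul (.load ((he _).mono hΓ) (hx _)) (evals_cell hL (by decide) (hx _)) ?_
  rw [hoff b hab, hoff _ haw, hf, hμ.weight_eq]
  exact (weighted_le W.base_pos f F).trans_lt (by simpa using hL.base_pow_lt (by omega))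

theorem executes_fits (hL : Large W B L) (hμ : CoverTables W u μ) (hu : u < W.n)
    (hx : ∀ μ, Γ.Evals μ (.var x) u) :
    Γ.Executes μ (fits (.var x)) (2 ^ W.k * ((W.k + 1) * 65))
      (Tabulated μ (fit u) fun F => ind (W.Fits u F)) := by
  have hprod (F T : Finset (Fin W.k)) : ind (W.Admissible F) * ∏ s ∈ T, ind (W.AuthNat s u) =
      ind (W.Admissible F ∧ ∀ s ∈ T, W.AuthNat s u) := by
    rw [prod_ind, ind_mul]
  have hone : 1 < 2 ^ L := (Nat.le_add_left 1 _).trans_lt hL.steps_lt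
  refine (executes_tabulateProd (N := 16) (N' := 11) (fun F => ind (W.Admissible F))
    (fun s => ind (W.AuthNat s u)) hL hμ.powers (ne_fit (by decide) u).symm
    (fun _ => evals_fitArray hL (hx _) hu)
    (fun F μ' hoff Γ' _ y hy => ?_) (fun s μ' _ Γ' hΓ z hz => ?_) (fun _ => le_rfl)
    (fun _ => le_rfl) fun F T => ?_).imp fun μ' h => ⟨h.off, fun F => (h.eq F).trans (hprod F F)⟩
  · rw [← hμ.admissible_eq, ← hoff admissible (ne_fit (by decide) u)]
    exact evals_cell hL (by decide) (hy _)
  · have hidx : s * W.n + u < 2 ^ L := lt_of_lt_of_le (by nlinarith [s.2]) hL.index.le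
    rw [← Workflow.input_auth s hu]
    refine .input (evals_lit hL (by decide)) (.add (.mul (hz _) (evals_users hL) (by omega))
      ((hx _).mono hΓ) hidx) ?_
    rw [Workflow.input_auth s hu]
    exact (ind_le_one _).trans_lt hone
  · rw [hprod]
    exact (ind_le_one _).trans_lt hone

theorem executes_combine (hL : Large W B L) (hμ : CoverTables W u μ) (hu : u < W.n)
    (hfit : ∀ F, μ (fit u) (mask F) = ind (W.Fits u F)) (hx : ∀ μ, Γ.Evals μ (.var x) u) :
    Γ.Executes μ (combine (.var x)) (2 ^ W.k * ((W.k + 1) * 220)) fun μ' =>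
      (∀ b, b ≠ left → b ≠ right → μ' b = μ b) ∧ ∀ F, μ' left (mask F) =
        unionProd (weighted W.base (W.Coverable u)) (weighted W.base (W.Fits u)) F := by
  refine Scope.Executes.mono (N := 2 ^ W.k * 29 + (2 ^ W.k * 29 + 2 ^ W.k * ((W.k + 1) * 162)))
    (.seq <| (executes_weigh hL hμ (by decide) (by decide) (ne_cover (by decide) u).symm
      (fun _ => evals_coverArray hL (hx _) hu.le) rfl (hμ.cover_eq u le_rfl)).imp
        fun μ₁ h₁ => ?_) (by
    simp only [← Nat.mul_add]
    exact Nat.mul_le_mul_left _ (by omega))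
  have ht₁ : CoverTables W u μ₁ := hμ.congr fun b hb _ => h₁.off b fun h => hb (h ▸ by decide)
  refine .seq <| (executes_weigh (f := W.Fits u) hL ht₁ (by decide) (by decide)
    (ne_fit (by decide) u).symm (fun _ => evals_fitArray hL (hx _) hu) rfl fun F =>
      h₁.off (fit u) (ne_fit (by decide) u).symm ▸ hfit F).imp fun μ₂ h₂ => ?_
  have ht₂ : CoverTables W u μ₂ := ht₁.congr fun b hb _ => h₂.off b fun h => hb (h ▸ by decide)
  have hle (f : Finset (Fin W.k) → Prop) (F) : weighted W.base f F ≤ W.base ^ W.k := by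
    simpa using weighted_le W.base_pos f F
  refine (executes_coveringProduct hL ht₂.powers (fun F => h₂.off left (by decide) ▸ h₁.eq F)
    h₂.eq (hle _) (hle _)).imp fun μ₃ h₃ => ⟨fun b hl hr => ?_, h₃.2⟩
  rw [h₃.1 b hl hr, h₂.off b hr, h₁.off b hl]

theorem CoverTables.succ {μ' : Mem} (h : CoverTables W u μ)
    (hfit : ∀ F, μ (fit u) (mask F) = ind (W.Fits u F))
    (hμ' : Tabulated μ (cover (u + 1)) (fun F => ind (W.Coverable (u + 1) F)) μ') :
    CoverTables W (u + 1) μ' := by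
  have hμ : CoverTables W u μ' := h.congr fun b _ hb =>
    hμ'.off b (by dsimp only [cover] at hb ⊢; omega)
  refine { hμ with fit_eq := fun v hv F => ?_, cover_eq := fun v hv F => ?_ }
  · obtain hv | rfl := Nat.lt_succ_iff_lt_or_eq.1 hv
    · exact hμ.fit_eq v hv F
    · rw [hμ'.off _ (by dsimp only [fit, cover]; omega), hfit]
  · obtain hv | rfl := Nat.le_succ_iff.1 hv
    · exact hμ.cover_eq v hv F
    · exact hμ'.eq F

theorem executes_extendCover (hL : Large W B L) (hμ : CoverTables W u μ) (hu : u < W.n)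
    (hx : ∀ μ, Γ.Evals μ (.var x) u) :
    Γ.Executes μ (extendCover (.var x)) (2 ^ W.k * ((W.k + 1) * 330)) (CoverTables W (u + 1)) := by
  refine Scope.Executes.mono (.seq <| (executes_fits hL hμ hu hx).imp fun μ₁ h₁ => ?_)
    (N := 2 ^ W.k * ((W.k + 1) * 65) + (2 ^ W.k * ((W.k + 1) * 220) + 2 ^ W.k * 45)) (by
    simp only [← Nat.mul_add]
    exact Nat.mul_le_mul_left _ (by omega))
  have ht₁ : CoverTables W u μ₁ := hμ.congr fun b _ hb => h₁.off b (Nat.lt_succ_of_le hb).ne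
  refine .seq <| (executes_combine hL ht₁ hu h₁.eq hx).imp fun μ₂ h₂ => ?_
  have ht₂ : CoverTables W u μ₂ := ht₁.congr fun b hb _ =>
    h₂.1 b (fun h => hb (h ▸ by decide)) fun h => hb (h ▸ by decide)
  have hfit (F) : μ₂ (fit u) (mask F) = ind (W.Fits u F) := by
    rw [h₂.1 _ (ne_fit (by decide) u).symm (ne_fit (by decide) u).symm, h₁.eq]
  refine (executes_tabulate (N := 31) (fun F => ind (W.Coverable (u + 1) F)) hL ht₂.powers
    (fun _ => evals_coverArray hL (.add (hx _) (evals_lit hL (by decide)) (hL.lt (by omega))) hu)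
    (fun F μ' hoff _ Γ' _ y hy => ?_) fun _ => le_rfl).imp fun _ h₃ => ht₂.succ hfit h₃
  rw [Workflow.Coverable, ← unionProd_weighted_mod_ne_zero (W.two_pow_card_lt_base F), ← h₂.2,
    ← one_sub_one_sub, pow_succ, ← ht₂.weight_eq,
    ← hoff left (ne_cover (by decide) _), ← hoff weight (ne_cover (by decide) _)]
  refine .sub (evals_lit hL (by decide)) (.sub (evals_lit hL (by decide))
    (.mod (evals_cell hL (by decide) (hy _)) (.mul (evals_cell hL (by decide) (hy _))
      (evals_base hL ?_) ?_)))
  · rw [Powers, hoff _ (ne_cover (by decide) _)]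
    exact ht₂.powers
  · rw [hoff weight (ne_cover (by decide) _), ht₂.weight_eq, ← pow_succ]
    exact hL.base_pow_lt (Nat.succ_le_succ (by simpa using Finset.card_le_univ F))

end Layers

/-- The command that fills the arrays `weight` and `cover 0`. -/
def initCover : Cmd :=
  tabulateProd (.lit weight) (fun _ => 1) (fun _ => base) ⨟ tabulate (coverArray 0) fun F => 1 - F

/-- The command that fills the arrays `weight`, `fit u` and `cover u`. -/
def covers : Cmd := initCover ⨟ .forTo users extendCover

section Covers

variable {W : Workflow} {B L : ℕ} {Γ : Scope W.input L} {μ : Mem}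

theorem executes_initCover (hL : Large W B L) (hμ : Powers W μ)
    (ha : ∀ F, μ admissible (mask F) = ind (W.Admissible F)) :
    Γ.Executes μ initCover (2 ^ W.k * ((W.k + 1) * 71)) (CoverTables W 0) := by
  have hbase {T : Finset (Fin W.k)} : 1 * ∏ _s ∈ T, W.base = W.base ^ T.card := by
    rw [Finset.prod_const, one_mul]
  refine Scope.Executes.mono (N := 2 ^ W.k * ((W.k + 1) * 48) + 2 ^ W.k * 23) (.seq <|
    (executes_tabulateProd (N := 3) (N' := 7) (fun _ => 1) (fun _ => W.base) hL hμ (by decide)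
      (fun _ => evals_lit hL (by decide)) (fun F μ' _ Γ' _ x _ => evals_lit hL (by decide))
      (fun s μ' hoff Γ' _ z _ => evals_base hL ?_) (fun _ => le_rfl) (fun _ => le_rfl)
      fun _ T => ?_).imp fun μ₁ h₁ => ?_) ?_
  · rwa [Powers, hoff _ (by decide)]
  · rw [hbase]
    exact hL.base_pow_lt ((Finset.card_le_univ T).trans (by simp))
  · have hp : Powers W μ₁ := by rwa [Powers, h₁.off _ (by decide)]
    refine (executes_tabulate (N := 9) (fun F => ind (W.Coverable 0 F)) hL hp
      (fun _ => evals_coverArray hL (evals_lit hL (by decide)) (Nat.zero_le _))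
      (fun F μ' _ _ Γ' _ x hx => ?_) fun _ => le_rfl).imp fun μ₂ h₂ => ?_
    · rw [Workflow.Coverable, ← one_sub_mask]
      exact .sub (evals_lit hL (by decide)) (hx _)
    · refine ⟨?_, fun F => ?_, fun F => ?_, fun u hu => absurd hu (Nat.not_lt_zero u), ?_⟩
      · rwa [Powers, h₂.off _ (by decide)]
      · rw [h₂.off _ (by decide), h₁.off _ (by decide), ha]
      · rw [h₂.off _ (by decide), h₁.eq, hbase]
      · rintro u hu F
        obtain rfl := Nat.le_zero.1 hu
        exact h₂.eq F
  · rw [← Nat.mul_add]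
    exact Nat.mul_le_mul_left _ (by omega)

theorem executes_covers (hL : Large W B L) (hμ : Powers W μ)
    (ha : ∀ F, μ admissible (mask F) = ind (W.Admissible F)) :
    Γ.Executes μ covers (2 ^ W.k * ((W.k + 1) * ((W.n + 1) * 334))) (CoverTables W W.n) := by
  refine (Scope.Executes.seq <| (executes_initCover hL hμ ha).imp fun μ₁ h₁ =>
    .forTo (CoverTables W) (evals_users hL) h₁ fun u hu μ' h Γ' _ x hx =>
      executes_extendCover hL h hu hx).mono ?_
  have : 1 ≤ 2 ^ W.k * (W.k + 1) := Nat.mul_pos (by positivity) (Nat.succ_pos _)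
  simp only [cost_users]
  nlinarith

end Covers

/-! ## Construction of a plan -/

/-- The user `u` can be given the steps of `C` outside `Y`, such that the users before `u` cover
`Y`. -/
def Workflow.Splits (W : Workflow) (u : ℕ) (C Y : Finset (Fin W.k)) : Prop :=
  Y ⊆ C ∧ W.Coverable u Y ∧ W.Fits u (C \ Y)

/-- The command that tests whether `Y` is a subset of the current set that the users before `u`
cover. -/
def testChoice (u Y : Expr) : Cmd :=
  prodTo steps (.lit test) 0 (.load (coverArray u) Y) (fun s => bit s Y) fun s =>
    bit s (cell current 0)

/-- The command that chooses `Y` if the user `u` can be given the other steps of the current set. -/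
def tryChoice (u Y : Expr) : Cmd :=
  testChoice u Y ⨟ .onlyIf (cell test 0) (.onlyIf (.load (fitArray u) (cell current 0 - Y))
    (.store (.lit choice) 0 Y))

/-- The command that gives the steps of the current set outside the choice to the user `u`. -/
def assign (u : Expr) : Cmd :=
  .forTo steps fun s => .onlyIf (bit s (cell current 0 - cell choice 0)) (.store (.lit plan) s u)

/-- The command that determines which steps of the current set the user `u` is given. -/
def assignUser (u : Expr) : Cmd :=
  .forTo numSets (tryChoice u) ⨟ assign u ⨟ .store (.lit current) 0 (cell choice 0)

/-- The command that constructs a plan, from the last user down to the first one. -/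
def backtrack : Cmd :=
  .store (.lit current) 0 (numSets - 1) ⨟ .forTo users fun j => assignUser (users - (j + 1))

section Backtracking

variable {W : Workflow} {B L u : ℕ} {C Y : Finset (Fin W.k)} {Γ : Scope W.input L} {μ : Mem}
  {e : Expr}

theorem executes_testChoice (hL : Large W B L) (hμ : CoverTables W W.n μ) (hu : u < W.n)
    (hC : μ current 0 = mask C) (he : ∀ μ, Γ.Evals μ e u) (hcost : e.cost = 8) {x : ℕ}
    (hx : ∀ μ, Γ.Evals μ (.var x) (mask Y)) :
    Γ.Executes μ (testChoice e (.var x)) ((W.k + 1) * 36 + 18)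
      (· = μ.set test 0 (ind (W.Coverable u Y ∧ Y ⊆ C))) := by
  have hcov (T : Finset (Fin W.k)) : ind (W.Coverable u Y) * ∏ s ∈ T, ind (s ∈ C) =
      ind (W.Coverable u Y ∧ T ⊆ C) := by
    rw [prod_ind, ind_mul]
    rfl
  have hcur {Γ' : Scope W.input L} {v} : Γ'.Evals (μ.set test 0 v) (cell current 0) (mask C) := by
    rw [← hC, ← μ.set_of_ne (show current ≠ test by decide) 0 v]
    exact evals_cell hL (by decide) (evals_zero hL)
  have hp {v} : Powers W (μ.set test 0 v) := by
    rw [Powers, μ.set_of_ne (by decide)]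
    exact hμ.powers
  have hload : Γ.Evals μ (.load (coverArray e) (.var x)) (ind (W.Coverable u Y)) :=
    hμ.cover_eq u hu.le Y ▸ .load (evals_coverArray hL (he _) hu.le) (hx _)
  refine ((executes_prodTo (N := 23) (test := fun s => bit s (.var x))
    (factor := fun s => bit s (cell current 0)) (fun s => ind (s ∈ Y)) (fun s => ind (s ∈ C))
    (fun _ => evals_steps hL) (fun _ => evals_lit hL (by decide)) (fun _ => evals_zero hL) hload
    (fun s v Γ' hΓ z hz => evals_bit hL hp (hz _) ((hx _).mono hΓ))
    (fun s v Γ' _ z hz => evals_bit hL hp (hz _) hcur) (fun _ => le_rfl) fun T => ?_).mono ?_).imp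
      fun μ' h => h.trans ?_
  · rw [hcov]
    exact (ind_le_one _).trans_lt (hL.lt (by omega))
  · simp [coverArray, hcost]
  · simp only [hcov, ind_ne_zero, Finset.filter_univ_mem]

theorem executes_tryChoice (hL : Large W B L) (hμ : CoverTables W W.n μ) (hu : u < W.n)
    (hC : μ current 0 = mask C) (he : ∀ μ, Γ.Evals μ e u) (hcost : e.cost = 8) {x : ℕ}
    (hx : ∀ μ, Γ.Evals μ (.var x) (mask Y)) :
    Γ.Executes μ (tryChoice e (.var x)) ((W.k + 1) * 85) fun μ' =>
      (∀ b, b ≠ choice → b ≠ test → μ' b = μ b) ∧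
        (W.Splits u C Y → μ' choice 0 = mask Y) ∧
        (¬ W.Splits u C Y → μ' choice 0 = μ choice 0) := by
  refine Scope.Executes.mono (N := (W.k + 1) * 36 + 18 + 31) (.seq <|
    (executes_testChoice hL hμ hu hC he hcost hx).imp ?_) (by omega)
  rintro _ rfl
  set μ₁ := μ.set test 0 (ind (W.Coverable u Y ∧ Y ⊆ C)) with hμ₁
  have hoff {b} (hb : b ≠ test) : μ₁ b = μ b := μ.set_of_ne hb _ _
  have htest : Γ.Evals μ₁ (cell test 0) (ind (W.Coverable u Y ∧ Y ⊆ C)) := by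
    convert evals_cell (μ := μ₁) hL (show test ≤ 9 by decide) (evals_zero hL) using 1
    simp [hμ₁]
  have hfit (hYC : Y ⊆ C) : Γ.Evals μ₁ (.load (fitArray e) (cell current 0 - .var x))
      (ind (W.Fits u (C \ Y))) := by
    rw [← hμ.fit_eq u hu, mask_sdiff hYC, ← hC, ← hoff (ne_fit (by decide) u).symm,
      ← hoff (show current ≠ test by decide)]
    exact .load (evals_fitArray hL (he _) hu)
      (.sub (evals_cell hL (by decide) (evals_zero hL)) (hx _))
  refine .mono (.onlyIf htest (fun hT => .onlyIf (N := 5) (hfit (ind_ne_zero.1 hT).2) (fun hF =>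
    .store (evals_lit hL (by decide)) (evals_zero hL) (hx _) ?_) fun hF => ?_) fun hT => ?_)
    (by simp [fitArray, hcost])
  · rw [ind_ne_zero] at hT hF
    have hY : W.Splits u C Y := ⟨hT.2, hT.1, hF⟩
    exact ⟨fun b hc ht => by rw [Mem.set_of_ne _ hc, hoff ht], fun _ => Mem.set_self ..,
      fun h => absurd hY h⟩
  · exact ⟨fun b _ ht => hoff ht, fun hY => absurd hF (ind_ne_zero.2 hY.2.2),
      fun _ => by rw [hoff (by decide)]⟩
  · exact ⟨fun b _ ht => hoff ht, fun hY => absurd hT (ind_ne_zero.2 ⟨hY.2.1, hY.1⟩),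
      fun _ => by rw [hoff (by decide)]⟩

theorem executes_search (hL : Large W B L) (hμ : CoverTables W W.n μ) (hu : u < W.n)
    (hC : μ current 0 = mask C) (hcov : W.Coverable (u + 1) C) (he : ∀ μ, Γ.Evals μ e u)
    (hcost : e.cost = 8) :
    Γ.Executes μ (.forTo numSets (tryChoice e)) (2 ^ W.k * ((W.k + 1) * 96)) fun μ' =>
      (∀ b, b ≠ choice → b ≠ test → μ' b = μ b) ∧ ∃ Y, W.Splits u C Y ∧ μ' choice 0 = mask Y := by
  refine ((Scope.Executes.forTo (N := (W.k + 1) * 85) (fun i μ' =>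
    (∀ b, b ≠ choice → b ≠ test → μ' b = μ b) ∧
      ((∃ Y, W.Splits u C Y ∧ mask Y < i) → ∃ Y, W.Splits u C Y ∧ μ' choice 0 = mask Y))
    (evals_numSets hL hμ.powers) ⟨fun _ _ _ => rfl, by simp⟩
    fun i hi μ₁ ⟨hoff, hY₁⟩ Γ' hΓ x hx => ?_).imp fun μ' ⟨hoff, hY⟩ => ⟨hoff, hY ?_⟩).mono ?_
  · obtain ⟨Y, rfl⟩ := exists_mask_eq hi
    have ht₁ : CoverTables W W.n μ₁ := hμ.congr fun b hb _ =>
      hoff b (fun h => hb (h ▸ by decide)) fun h => hb (h ▸ by decide)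
    refine (executes_tryChoice hL ht₁ hu (hoff current (by decide) (by decide) ▸ hC)
      (fun _ => (he _).mono hΓ) hcost hx).imp fun μ₂ ⟨hoff₂, hpos, hneg⟩ =>
        ⟨fun b hc ht => by rw [hoff₂ b hc ht, hoff b hc ht], fun ⟨Z, hZ, hlt⟩ => ?_⟩
    by_cases hY : W.Splits u C Y
    · exact ⟨Y, hY, hpos hY⟩
    · have hne : mask Z ≠ mask Y := fun h => hY (mask_injective h ▸ hZ)
      rw [hneg hY]
      exact hY₁ ⟨Z, hZ, by omega⟩
  · have := Nat.one_le_two_pow (n := W.k)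
    simp only [cost_numSets]
    nlinarith
  · obtain ⟨Y, hY⟩ : ∃ Y, W.Splits u C Y := hcov
    exact ⟨Y, hY, mask_lt Y⟩

theorem executes_assign (hL : Large W B L) (hp : Powers W μ) (hYC : Y ⊆ C)
    (hC : μ current 0 = mask C) (hY : μ choice 0 = mask Y) (he : ∀ μ, Γ.Evals μ e u)
    (hcost : e.cost = 8) :
    Γ.Executes μ (assign e) ((W.k + 1) * 34) fun μ' => (∀ b ≠ plan, μ' b = μ b) ∧
      ∀ s : Fin W.k, (s ∈ C \ Y → μ' plan s = u) ∧ (s ∉ C \ Y → μ' plan s = μ plan s) := by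
  set v := fun i => if mask (C \ Y) / 2 ^ i % 2 = 0 then μ plan i else u with hv
  refine ((Scope.Executes.fill (N := 30) v (evals_steps hL) fun i hi μ' hμ' Γ' hΓ z hz => ?_).imp
    fun μ' h => ⟨h.off, fun s => ?_⟩).mono (by simp only [cost_steps]; omega)
  · lift i to Fin W.k using hi
    have hp' : Powers W μ' := by rwa [Powers, hμ'.off _ (by decide)]
    have hrest : Γ'.Evals μ' (cell current 0 - cell choice 0) (mask (C \ Y)) := by
      rw [mask_sdiff hYC, ← hC, ← hY, ← hμ'.off current (by decide), ← hμ'.off choice (by decide)]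
      exact .sub (evals_cell hL (by decide) (evals_zero hL))
        (evals_cell hL (by decide) (evals_zero hL))
    refine .mono (.onlyIf (evals_bit hL hp' (hz _) hrest) (fun h => .store
      (evals_lit hL (by decide)) (hz _) ((he _).mono hΓ) ?_) fun h => ?_) (by simp [hcost])
    · rw [← mask_div_mod] at h
      simp [hv, h]
    · rw [← mask_div_mod] at h
      simp [hv, h, ← hμ'.todo, Mem.set]
  · rw [h.done s s.2, hv]
    simp only [mask_div_mod]
    exact ⟨fun hs => by rw [ind_of_true hs, if_neg one_ne_zero],
      fun hs => by rw [ind_of_false hs, if_pos rfl]⟩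

/-- The tables are complete, and the array `plan` holds a plan for the users from number `u` on that
leaves the current set to the users before `u`. -/
def Backtracked (W : Workflow) (u : ℕ) (μ : Mem) : Prop :=
  CoverTables W W.n μ ∧ ∃ C, μ current 0 = mask C ∧ W.PartialPlan u C fun s => μ plan s

theorem executes_assignUser (hL : Large W B L) (hμ : Backtracked W (u + 1) μ) (hu : u < W.n)
    (he : ∀ μ, Γ.Evals μ e u) (hcost : e.cost = 8) :
    Γ.Executes μ (assignUser e) (2 ^ W.k * ((W.k + 1) * 136)) (Backtracked W u) := by
  obtain ⟨ht, C, hC, hp⟩ := hμ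
  refine .mono (.seq <| (executes_search hL ht hu hC hp.coverable he hcost).imp
    fun μ₁ ⟨hoff₁, Y, ⟨hYC, hY, hfits⟩, hY₁⟩ => .seq <| Scope.Executes.imp (executes_assign hL
      ?_ hYC (hoff₁ current (by decide) (by decide) ▸ hC) hY₁ he hcost)
      fun μ₂ ⟨hoff₂, hplan⟩ => .store (evals_lit hL (by decide)) (evals_zero hL)
        (evals_cell hL (by decide) (evals_zero hL)) ?_) ?_
  · rw [Powers, hoff₁ _ (by decide) (by decide)]
    exact ht.powers
  · have hoff {b} (hb : b ∉ scratch) : μ₂ b = μ b := by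
      rw [hoff₂ b fun h => hb (h ▸ by decide), hoff₁ b (fun h => hb (h ▸ by decide))
        fun h => hb (h ▸ by decide)]
    refine ⟨ht.congr fun b hb _ => ?_, Y, ?_, hp.assign hYC hY hfits (fun s hs => ?_)
      fun s hs => ?_⟩
    · rw [Mem.set_of_ne _ fun h : b = current => hb (h ▸ by decide), hoff hb]
    · rw [Mem.set_self, hoff₂ choice (by decide), hY₁]
    · rw [Mem.set_of_ne _ (by decide), (hplan s).1 hs]
    · rw [Mem.set_of_ne _ (by decide), (hplan s).2 hs, hoff₁ plan (by decide) (by decide)]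
  · have := Nat.one_le_two_pow (n := W.k)
    simp only [Expr.cost_lit, Expr.cost_ofNat, cost_cell]
    nlinarith

theorem executes_backtrack (hL : Large W B L) (hμ : CoverTables W W.n μ)
    (hcov : W.Coverable W.n Finset.univ) :
    Γ.Executes μ backtrack (2 ^ W.k * ((W.k + 1) * ((W.n + 1) * 140))) (Backtracked W 0) := by
  have h2 := Nat.one_le_two_pow (n := W.k)
  refine (Scope.Executes.seq <| .store (evals_lit hL (by decide)) (evals_zero hL)
    (.sub (evals_numSets hL hμ.powers) (evals_lit hL (by decide))) <|
    (Scope.Executes.forTo (N := 2 ^ W.k * ((W.k + 1) * 136)) (fun j => Backtracked W (W.n - j))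
      (evals_users hL) ⟨?_, Finset.univ, ?_, .of_coverable hcov _⟩
      fun j hj μ' h Γ' _ x hx => ?_).imp fun μ' h => ?_).mono ?_
  · exact hμ.congr fun b hb _ => Mem.set_of_ne _ (fun h : b = current => hb (h ▸ by decide)) _ _
  · rw [Mem.set_self, mask_univ]
  · obtain ⟨u, hu⟩ : ∃ u, W.n = u + (j + 1) := ⟨W.n - (j + 1), by omega⟩
    rw [show W.n - j = u + 1 by omega] at h
    rw [show W.n - (j + 1) = u by omega]
    refine executes_assignUser hL h (by omega) (fun _ => ?_) rfl
    rw [show u = W.n - (j + 1) by omega]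
    exact .sub (evals_users hL) (.add (hx _) (evals_lit hL (by decide)) (hL.lt (by omega)))
  · simpa only [Nat.sub_self] using h
  · simp only [Expr.cost_lit, Expr.cost_ofNat, Expr.cost_sub, cost_numSets, cost_users]
    nlinarith [Nat.mul_le_mul h2 (Nat.le_add_left 1 W.k)]

end Backtracking

/-- The expression that tells whether there is a valid plan, once the tables are complete. -/
def satisfiable : Expr := .load (coverArray users) (numSets - 1)

/-- The command that leaves a valid plan in the array `plan`, if there is one. -/
def construct (E : Prog) : Cmd :=
  powers ⨟ eligibility E ⨟ admissibility ⨟ covers ⨟ .onlyIf satisfiable backtrack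

/-- The program that solves the workflow satisfiability problem by means of the eligibility
test `E`. -/
def solver (E : Prog) : Prog := construct E 0 ;; satisfiable.code 0

@[simp] theorem cost_satisfiable : satisfiable.cost = 15 := rfl

theorem Solves.mono {P : Prog} {W : Workflow} {B B' : ℕ} (h : Solves P W B) (hB : B ≤ B') :
    Solves P W B' :=
  let ⟨t, σ, hrun, ht, hσ⟩ := h
  ⟨t, σ, hrun, ht.trans hB, hσ⟩

section Solver

variable {W : Workflow} {B L : ℕ} {Γ : Scope W.input L} {μ : Mem} {E : Prog}

theorem evals_satisfiable (hL : Large W B L) (hμ : CoverTables W W.n μ) :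
    Γ.Evals μ satisfiable (ind (W.Coverable W.n Finset.univ)) := by
  rw [← hμ.cover_eq W.n le_rfl, mask_univ]
  exact .load (evals_coverArray hL (evals_users hL) le_rfl)
    (.sub (evals_numSets hL hμ.powers) (evals_lit hL (by decide)))

theorem executes_construct (hE : DecidesEligibility E W B) (hL : Large W B L)
    (hμ : ∀ a i, μ a i = 0) :
    Γ.Executes μ (construct E)
      (2 ^ W.k * (W.k + 1) * ((W.c + W.n + 1) * (E.regBound + 3 * B + 585))) fun μ' =>
        CoverTables W W.n μ' ∧ (W.Coverable W.n Finset.univ → Backtracked W 0 μ') := by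
  refine .mono (.seq <| (executes_powers hL μ).imp fun μ₁ ⟨hoff₁, hp₁⟩ => .seq <|
    (executes_eligibility hE hL hp₁ fun a ha => ?_).imp fun μ₂ h₂ => .seq <|
      (executes_admissibility hL ?_ fun F j => ?_).imp fun μ₃ h₃ => .seq <|
        (executes_covers hL ?_ h₃.eq).imp fun μ₄ h₄ =>
          .onlyIf (evals_satisfiable hL h₄)
            (fun h => (executes_backtrack hL h₄ (ind_ne_zero.1 h)).imp fun μ₅ h₅ =>
              ⟨h₅.1, fun _ => h₅⟩)
            fun h => ⟨h₄, fun hcov => absurd h (ind_ne_zero.2 hcov)⟩) ?_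
  · rw [hoff₁ a (by unfold power; omega)]
    exact funext (hμ a)
  · rw [Powers, h₂.keep _ (by unfold power; omega) (by decide)]
    exact hp₁
  · exact h₂.table F j (mask_mul_add_lt F j)
  · rw [Powers, h₃.off _ (by decide), h₂.keep _ (by unfold power; omega) (by decide)]
    exact hp₁
  · have h2 := Nat.one_le_two_pow (n := W.k)
    obtain ⟨P, hP⟩ := Nat.exists_eq_add_of_le' h2
    rw [cost_satisfiable, hP]
    ring_nf
    omega

theorem solves_solver (hE : DecidesEligibility E W B) (hL : Large W B L)
    (regular : ∀ j, (W.con j).Regular) :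
    Solves (solver E) W
      (2 ^ W.k * (W.k + 1) * ((W.c + W.n + 1) * (E.regBound + 3 * B + 600)) * (3 * L + 1)) := by
  let Γ : Scope W.input L := ⟨0, fun _ => 0⟩
  have hcost : 1 ≤ 2 ^ W.k * (W.k + 1) * (W.c + W.n + 1) := Nat.mul_pos (by positivity) (by omega)
  obtain ⟨t, σ, hrun, ht, -, hσ⟩ := WP.seq ((executes_construct (Γ := Γ) hE hL (fun _ _ => rfl)
    (start []) (fun _ hx => absurd hx (Nat.not_lt_zero _)) rfl).imp fun σ ⟨hσ, ht, hb⟩ =>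
      (evals_satisfiable hL ht 0 le_rfl σ hσ rfl).imp fun σ' h' => (⟨h'.reg, h'.mem ▸ hb⟩ :
        σ'.reg 0 = ind (W.Coverable W.n Finset.univ) ∧
          (W.Coverable W.n Finset.univ → Backtracked W 0 σ'.mem))) (bdd_start L)
  refine ⟨t, σ, hrun, ht.trans (Nat.mul_le_mul_right _ ?_), ?_⟩
  · rw [cost_satisfiable]
    linarith
  · by_cases hcov : W.Coverable W.n Finset.univ
    · obtain ⟨-, C, -, hp⟩ := hσ.2 hcov
      obtain ⟨π, hπ, hs⟩ := hp.exists_valid regular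
      exact .inl ⟨hσ.1.trans (ind_of_true hcov), π, hπ, hs⟩
    · exact .inr ⟨hσ.1.trans (ind_of_false hcov), fun ⟨π, hπ⟩ => hcov hπ.coverable⟩

end Solver

/-! ## The running time -/

/-- The number of bits that describe the size of the workflow. -/
def Workflow.bits (W : Workflow) : ℕ := W.k + W.n.size + W.c.size + 1

theorem large_bits (W : Workflow) (B : ℕ) : Large W B (B + 5 * W.bits ^ 2) := by
  have hb : W.bits = W.k + W.n.size + W.c.size + 1 := rfl
  have hpow {m x : ℕ} (hm : m < B + 5 * W.bits ^ 2) (hx : x ≤ 2 ^ m) :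
      x < 2 ^ (B + 5 * W.bits ^ 2) :=
    hx.trans_lt (Nat.pow_lt_pow_right one_lt_two hm)
  have hn : W.n ≤ 2 ^ W.n.size := (Nat.lt_size_self _).le
  have hc : W.c ≤ 2 ^ W.c.size := (Nat.lt_size_self _).le
  have hsq : W.bits ≤ W.bits ^ 2 := Nat.le_self_pow two_ne_zero _
  have hk : (W.k + 1) ^ 2 ≤ W.bits ^ 2 := Nat.pow_le_pow_left (by omega) 2
  constructor
  · have h₁ : 2 ^ W.n.size ≤ 2 ^ (W.k + W.n.size + W.c.size) :=
      Nat.pow_le_pow_right two_pos (by omega)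
    have h₂ : 2 ^ W.k * 2 ^ W.c.size ≤ 2 ^ (W.k + W.n.size + W.c.size) := by
      rw [← pow_add]
      exact Nat.pow_le_pow_right two_pos (by omega)
    have h₃ := Nat.mul_le_mul_left (2 ^ W.k) hc
    have h₄ := Nat.one_le_two_pow (n := W.k + W.n.size + W.c.size)
    refine hpow (m := B + (W.k + W.n.size + W.c.size + 4)) (by omega) ?_
    rw [pow_add 2 B, pow_add _ _ 4]
    exact Nat.mul_le_mul_left _ (by omega)
  · refine hpow (m := W.k + W.n.size) (by omega) ?_
    rw [pow_add]
    exact Nat.mul_le_mul Nat.lt_two_pow_self.le hn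
  · refine hpow (m := (W.k + (W.k + 1) * W.k) * 2) (by nlinarith) ?_
    rw [Workflow.base, ← pow_mul, ← pow_add, ← pow_mul]
  · refine hpow (m := (W.k + 1) * (W.k + 1)) (by nlinarith) ?_
    rw [Workflow.base, ← pow_mul]

theorem Workflow.eq_zero_of_bound_eq_zero {W : Workflow} (h : W.bound = 0) :
    W.k = 0 ∧ W.n = 0 ∧ W.c = 0 := by
  obtain ⟨hc, hn⟩ : W.c = 0 ∧ W.n = 0 := by simpa [bound] using h
  refine ⟨Nat.eq_zero_of_not_pos fun hk => ?_, hn, hc⟩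
  obtain ⟨u, -⟩ := W.exists_auth ⟨0, hk⟩
  exact absurd u.2 (by omega)

theorem Workflow.bits_le_log_bound (W : Workflow) : W.bits ≤ 3 * Nat.log 2 W.bound + 3 := by
  rcases eq_or_ne W.bound 0 with h | h
  · obtain ⟨hk, hn, hc⟩ := eq_zero_of_bound_eq_zero h
    simp [bits, hk, hn, hc]
  · have hlt : W.bound < 2 ^ (Nat.log 2 W.bound + 1) := Nat.lt_pow_succ_log_self one_lt_two _
    have hle : W.c + W.n ^ 2 ≤ W.bound := Nat.le_mul_of_pos_left _ (by positivity)
    have hsq : W.n ≤ W.n ^ 2 := Nat.le_self_pow two_ne_zero _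
    have hk : W.k ≤ Nat.log 2 W.bound := Nat.le_log_of_pow_le one_lt_two
      (Nat.le_mul_of_pos_right _ (Nat.pos_of_ne_zero (right_ne_zero_of_mul h)))
    have hn : W.n.size ≤ Nat.log 2 W.bound + 1 := Nat.size_le.2 (by omega)
    have hc : W.c.size ≤ Nat.log 2 W.bound + 1 := Nat.size_le.2 (by omega)
    rw [bits]
    omega

theorem Workflow.two_pow_mul_le_bound (W : Workflow) :
    2 ^ W.k * (W.c + W.n + 1) ≤ 2 * W.bound + 1 := by
  rcases eq_or_ne W.bound 0 with h | h
  · obtain ⟨hk, hn, hc⟩ := eq_zero_of_bound_eq_zero h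
    simp [hk, hn, hc]
  · have hpos := Nat.pos_of_ne_zero (right_ne_zero_of_mul h)
    have hsq : W.n ≤ W.n ^ 2 := Nat.le_self_pow two_ne_zero _
    calc 2 ^ W.k * (W.c + W.n + 1) ≤ 2 ^ W.k * (2 * (W.c + W.n ^ 2)) :=
          Nat.mul_le_mul_left _ (by omega)
      _ = 2 * W.bound := by rw [bound, mul_left_comm]
      _ ≤ 2 * W.bound + 1 := Nat.le_succ _

theorem mul_log_pow_le (T e : ℕ) :
    (2 * T + 1) * (3 * Nat.log 2 T + 3) ^ e ≤ 3 * 6 ^ e * (T * Nat.log 2 T ^ e + 1) := by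
  rcases lt_or_ge T 2 with hT | hT
  · rw [Nat.log_of_lt hT]
    exact (Nat.mul_le_mul (by omega) (Nat.pow_le_pow_left (by norm_num) e)).trans
      (Nat.le_mul_of_pos_right _ (Nat.succ_pos _))
  · have hlog : 1 ≤ Nat.log 2 T := Nat.log_pos one_lt_two hT
    calc (2 * T + 1) * (3 * Nat.log 2 T + 3) ^ e ≤ 3 * T * (6 * Nat.log 2 T) ^ e :=
          Nat.mul_le_mul (by omega) (Nat.pow_le_pow_left (by omega) e)
      _ = 3 * 6 ^ e * (T * Nat.log 2 T ^ e) := by ring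
      _ ≤ 3 * 6 ^ e * (T * Nat.log 2 T ^ e + 1) := Nat.mul_le_mul_left _ (Nat.le_succ _)

theorem solver_cost_le (W : Workflow) (R a d : ℕ) :
    2 ^ W.k * (W.k + 1) * ((W.c + W.n + 1) * (R + 3 * (a * W.bits ^ d) + 600)) *
        (3 * (a * W.bits ^ d + 5 * W.bits ^ 2) + 1) ≤
      (R + 3 * a + 600) * (3 * a + 16) * (2 ^ W.k * (W.c + W.n + 1) * W.bits ^ (2 * d + 3)) := by
  have hk : W.k + 1 ≤ W.bits := by
    rw [Workflow.bits]
    omega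
  have hd : 1 ≤ W.bits ^ d := Nat.one_le_pow _ _ (by omega)
  have h2 : 1 ≤ W.bits ^ 2 := Nat.one_le_pow _ _ (by omega)
  set x := W.bits ^ d
  set y := W.bits ^ 2
  have hR : R + 3 * (a * x) + 600 ≤ (R + 3 * a + 600) * x := by nlinarith
  have hL : 3 * (a * x + 5 * y) + 1 ≤ (3 * a + 16) * (x * y) := by
    have hx : x ≤ x * y := Nat.le_mul_of_pos_right _ h2
    have hy : y ≤ x * y := Nat.le_mul_of_pos_left _ hd
    nlinarith
  calc _ ≤ 2 ^ W.k * W.bits * ((W.c + W.n + 1) * ((R + 3 * a + 600) * x)) *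
        ((3 * a + 16) * (x * y)) := by gcongr
    _ = (R + 3 * a + 600) * (3 * a + 16) *
        (2 ^ W.k * (W.c + W.n + 1) * (W.bits * (x * x) * y)) := by ring
    _ = _ := by
      congr 2
      simp only [x, y]
      ring

end WSP

theorem theorem1 (𝒲 : Set WSP.Workflow)
    (regular : ∀ W ∈ 𝒲, ∀ j, (W.con j).Regular)
    (eligibility : ∃ (E : RAM.Prog) (a d : ℕ), ∀ W ∈ 𝒲,
      WSP.DecidesEligibility E W (a * (W.k + W.n.size + W.c.size + 1) ^ d)) :
    ∃ (P : RAM.Prog) (K d : ℕ), ∀ W ∈ 𝒲,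
      WSP.Solves P W (K * (W.bound * Nat.log 2 W.bound ^ d + 1)) := by
  obtain ⟨E, a, d, hE⟩ := eligibility
  refine ⟨WSP.solver E, (E.regBound + 3 * a + 600) * (3 * a + 16) * (3 * 6 ^ (2 * d + 3)),
    2 * d + 3, fun W hW =>
    .mono (WSP.solves_solver (hE W hW) (WSP.large_bits W _) (regular W hW)) ?_⟩
  calc _ ≤ (E.regBound + 3 * a + 600) * (3 * a + 16) *
        (2 ^ W.k * (W.c + W.n + 1) * W.bits ^ (2 * d + 3)) := WSP.solver_cost_le W E.regBound a d
    _ ≤ (E.regBound + 3 * a + 600) * (3 * a + 16) *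
        ((2 * W.bound + 1) * (3 * Nat.log 2 W.bound + 3) ^ (2 * d + 3)) := by
      gcongr
      exacts [W.two_pow_mul_le_bound, W.bits_le_log_bound]
    _ ≤ _ := by
      rw [mul_assoc _ (3 * 6 ^ (2 * d + 3))]
      exact Nat.mul_le_mul_left _ (WSP.mul_log_pow_le _ _)
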